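/- Work in the closed unit ball of $\mathbb R^3$, with spherical coordinates $(r,\theta,\phi)$ and cylindrical coordinates $(s,\phi,z)$; for $0<s<1$ let $C(s)$ be the cylinder of radius $s$ about the $z$-axis inside the ball, $|z|\le Z=\sqrt{1-s^2}$. Let $A=\sqrt{231/20584}$, let $\eta\in\mathbb R$ be constant, and let $$\mathbf B=\nabla\times\nabla\times\big(\mathcal S(r)\cos\theta\,\hat{\mathbf r}\big),\qquad \mathcal S(r)=A\,r^2(30r^4-57r^2+25).$$ (1) $\mathbf B$ satisfies the insulating boundary condition $\mathcal S'(1)+\mathcal S(1)=0$ (its toroidal scalar is $0$) and is a Taylor state: $\int_{C(s)}\big([\nabla\times\mathbf B]\times\mathbf B\big)_\phi\,s\,d\phi\,dz=0$ for all $0<s<1$. (2) There is exactly one ageostrophic flow $\mathbf u_a$ of $\mathbf B$, i.e. a flow, continuous on the closed ball and $C^1$ inside, with $\hat{\mathbf z}\times\mathbf u_a=-\nabla p+(\nabla\times\mathbf B)\times\mathbf B$ for some pressure $p$, $\nabla\cdot\mathbf u_a=0$, zero normal component on $r=1$, and $\int_{C(s)}(\mathbf u_a)_\phi\,d\phi\,dz=0$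 for $0<s<1$. It is $\mathbf u_a=u_\phi\hat{\boldsymbol\phi}$ with $$u_\phi=A^2\big[9120s^7+(50400z^2-26184)s^5+(50400z^4-95760z^2+23888)s^3+(16800z^6-47880z^4+42000z^2-6824)s\big].$$ Put $\mathbf C^a=\nabla\times(\mathbf u_a\times\mathbf B)+\eta\nabla^2\mathbf B$ and $$\alpha_0=2\pi s^2\!\int_{-Z}^{Z}\!B_s^2\,dz,\quad S_0=2\pi s^2\!\int_{-Z}^{Z}\!(B_sC^a_\phi+B_\phi C^a_s)\,dz,\quad \alpha=\int_{C(s)}\! s^2B_s^2\,d\phi\,dz,\quad \beta=\int_{C(s)}\![2B_s^2+s\,\mathbf B\cdot\nabla B_s]\,s\,d\phi\,dz,$$ $$G=-\frac1s\frac{d}{ds}\Big[s^2\int_{C(s)}(C^a_\phi B_s+C^a_sB_\phi)\,d\phi\,dz\Big],\qquad \widetilde G=-\int_{C(s)}\big\{[\nabla\times\mathbf C^a]\times\mathbf B+[\nabla\times\mathbf B]\times\mathbf C^a\big\}_\phi\,s\,d\phi\,dz .$$ The BWR equation is $s\,\alpha_0\,(u_g/s)'=-S_0$. Taylor's equation is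 $\mathcal L_T(u_g):=\alpha\,(u_g/s)''+\beta\,(u_g/s)'=G$; $\widetilde G$ is the right side obtained instead by substituting $\mathbf C^a$ for $\partial_t\mathbf B$ directly in the time derivative of Taylor's integral. (3) For $0<s<1$, $$\alpha_0=\alpha=\tfrac{198}{2573}\pi s^4(1-s^2)^{3/2}(640s^4-1168s^2+535),$$ $$\beta=-\tfrac{198}{2573}\pi s^3(1-s^2)^{1/2}(7680s^6-17440s^4+12456s^2-2689),$$ $$S_0=\tfrac{66528}{86064277}\pi s^4(1-s^2)^{5/2}(46387200s^8-138624000s^6+142265512s^4-57599212s^2+7255185).$$ (4) Let $Q_2(x)=640x^2-1168x+535$. There are real polynomials $Q_9$ of degree $9$, coprime to $Q_2$, and $Q_7,\widetilde Q_7$ of degree $7$, such that $Q_2(s^2)\neq0$, $G=\sqrt{1-s^2}\,Q_7(s^2)$ and $\widetilde G=\sqrt{1-s^2}\,\widetilde Q_7(s^2)$ for $0<s<1$, and such that every solution $u_g$ of the BWR equation on an open interval $(a,b)\subseteq(0,1)$ satisfies there $$\mathcal L_T(u_g)=\frac{\sqrt{1-s^2}\,Q_9(s^2)}{Q_2(s^2)};$$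 moreover $Q_9/Q_2\ne Q_7$ and $Q_9/Q_2\neq\widetilde Q_7$ as rational functions. Consequently, on no non-empty open interval $(a,b)\subseteq(0,1)$ does any solution of the BWR equation solve Taylor's equation $\mathcal L_T(u_g)=G$, nor does any solve $\mathcal L_T(u_g)=\widetilde G$. (5) The solutions of the BWR equation on $(0,1)$ are exactly the functions $$u_g=\frac{A^2s}{918060}\Big[9926860800s^6-32213813760s^4+37855940880s^2+C-11143964160\ln s+30664844\sqrt{21}\arctan\!\Big(\frac{80s^2-73}{\sqrt{21}}\Big)+101695629\ln(640s^4-1168s^2+535)\Big],$$ $C\in\mathbb R$. Exactly one $C$ gives zero global angular momentum, $\int_0^1\int_{C(s)}s\big((\mathbf u_a)_\phi+u_g\big)\,d\phi\,dz\,s\,ds=0$. For every $C$, $u_g$ (with $u_g(0)=0$) is continuous on $[0,1]$ and analytic on $(0,1]$, including at $s=1$, and $s\,(u_g/s)'$ tends to a non-zero constant as $s\to0^+$. -/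

import Mathlib

noncomputable section

/-- Physical space. -/
abbrev E3 : Type := EuclideanSpace ℝ (Fin 3)

/-! ### Vector calculus in Cartesian coordinates -/

/-- Partial derivative `∂f/∂xᵢ` of a scalar field. -/
def partialD (i : Fin 3) (f : E3 → ℝ) (x : E3) : ℝ :=
  fderiv ℝ f x (EuclideanSpace.single i 1)

def curl (F : E3 → E3) (x : E3) : E3 :=
  !₂[partialD 1 (fun y => F y 2) x - partialD 2 (fun y => F y 1) x,
     partialD 2 (fun y => F y 0) x - partialD 0 (fun y => F y 2) x,
     partialD 0 (fun y => F y 1) x - partialD 1 (fun y => F y 0) x]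

def divergence (F : E3 → E3) (x : E3) : ℝ :=
  ∑ i : Fin 3, partialD i (fun y => F y i) x

/-- The cross product of two vectors of Euclidean 3-space. -/
def cross (u v : E3) : E3 :=
  WithLp.toLp 2 (crossProduct (WithLp.ofLp u) (WithLp.ofLp v))

/-- The Lorentz force `(∇ × B) × B`. -/
def lorentz (B : E3 → E3) (x : E3) : E3 := cross (curl B x) (B x)

/-! ### Cylindrical coordinates `(s, φ, z)` -/

/-- The point with cylindrical coordinates `(s, φ, z)`. -/
def cylPt (s φ z : ℝ) : E3 := !₂[s * Real.cos φ, s * Real.sin φ, z]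

/-- The unit vector in the azimuthal direction at azimuth `φ`. -/
def ePhi (φ : ℝ) : E3 := !₂[-Real.sin φ, Real.cos φ, 0]

/-- The unit vector along the rotation axis. -/
def eZ : E3 := !₂[0, 0, 1]

/-- The component `F_s` of a vector field, away from the axis. -/
def sComp (F : E3 → E3) (x : E3) : ℝ :=
  (x 0 * F x 0 + x 1 * F x 1) / Real.sqrt (x 0 ^ 2 + x 1 ^ 2)

/-- The component `F_φ` of a vector field, away from the axis. -/
def phiComp (F : E3 → E3) (x : E3) : ℝ :=
  (x 0 * F x 1 - x 1 * F x 0) / Real.sqrt (x 0 ^ 2 + x 1 ^ 2)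

/-- The integral `∫_{C(s)} f dφ dz` over the geostrophic cylinder of radius `s` in the unit ball. -/
def cylInt (f : E3 → ℝ) (s : ℝ) : ℝ :=
  ∫ φ in (0 : ℝ)..(2 * Real.pi),
    ∫ z in (-Real.sqrt (1 - s ^ 2))..(Real.sqrt (1 - s ^ 2)), f (cylPt s φ z)

/-! ### Magnetostrophic dynamics in the unit ball -/

/-- Taylor's integral `T(s) = ∫_{C(s)} ([∇ × B] × B)_φ s dφ dz`. -/
def taylorIntegral (B : E3 → E3) (s : ℝ) : ℝ :=
  cylInt (fun x => phiComp (lorentz B) x * s) s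

/-- `B` is a Taylor state: Taylor's integral vanishes on every geostrophic cylinder. -/
def IsTaylorState (B : E3 → E3) : Prop :=
  ∀ s ∈ Set.Ioo (0 : ℝ) 1, taylorIntegral B s = 0

/-- Electrically insulating conditions at `r = 1` for the poloidal and toroidal scalars `S`, `T`
of a spherical harmonic component of degree `l`. -/
def InsulatingBC (l : ℕ) (S T : ℝ → ℝ) : Prop :=
  deriv S 1 + l * S 1 = 0 ∧ T 1 = 0

/-- `u` is the ageostrophic flow driven by `B` (no buoyancy) in the unit ball: it solves the
magnetostrophic balance `ẑ × u = -∇p + (∇ × B) × B` for some pressure `p`, is incompressible, does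
not penetrate the boundary, and its azimuthal component has zero average over every geostrophic
cylinder. -/
structure IsAgeostrophicFlow (B u : E3 → E3) : Prop where
  continuousOn : ContinuousOn u (Metric.closedBall 0 1)
  contDiffOn : ContDiffOn ℝ 1 u (Metric.ball 0 1)
  balance : ∃ p : E3 → ℝ, DifferentiableOn ℝ p (Metric.ball 0 1) ∧
    ∀ x ∈ Metric.ball (0 : E3) 1, cross eZ (u x) = -gradient p x + lorentz B x
  incompressible : ∀ x ∈ Metric.ball (0 : E3) 1, divergence u x = 0
  impenetrable : ∀ x ∈ Metric.sphere (0 : E3) 1, inner ℝ (u x) x = 0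
  zero_average : ∀ s ∈ Set.Ioo (0 : ℝ) 1, cylInt (phiComp u) s = 0

/-- `Cᵃ = ∇ × (uₐ × B) + η ∇² B`. -/
def inductionC (η : ℝ) (B u : E3 → E3) (x : E3) : E3 :=
  curl (fun y => cross (u y) (B y)) x + η • Laplacian.laplacian B x

/-! ### The first-order (Braginsky-Wu-Roberts) equation, for axisymmetric fields -/

/-- `α₀(s) = 2π s² ∫ B_s² dz`, evaluated in the meridional half-plane `φ = 0`. -/
def alpha0 (B : E3 → E3) (s : ℝ) : ℝ :=
  2 * Real.pi * s ^ 2 *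
    ∫ z in (-Real.sqrt (1 - s ^ 2))..(Real.sqrt (1 - s ^ 2)), sComp B (cylPt s 0 z) ^ 2

/-- `S₀(s) = 2π s² ∫ (B_s Cᵃ_φ + B_φ Cᵃ_s) dz`, evaluated in the half-plane `φ = 0`. -/
def S0 (η : ℝ) (B u : E3 → E3) (s : ℝ) : ℝ :=
  2 * Real.pi * s ^ 2 *
    ∫ z in (-Real.sqrt (1 - s ^ 2))..(Real.sqrt (1 - s ^ 2)),
      (sComp B (cylPt s 0 z) * phiComp (inductionC η B u) (cylPt s 0 z)
        + phiComp B (cylPt s 0 z) * sComp (inductionC η B u) (cylPt s 0 z))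

/-- `ug` solves `s α₀(s) (ug/s)' = -S₀(s)` on the set `I`. -/
def SolvesBWR (η : ℝ) (B u : E3 → E3) (I : Set ℝ) (ug : ℝ → ℝ) : Prop :=
  ∀ s ∈ I, DifferentiableAt ℝ (fun t => ug t / t) s ∧
    s * alpha0 B s * deriv (fun t => ug t / t) s = -S0 η B u s

/-! ### Taylor's second-order equation -/

/-- `α(s) = ∫_{C(s)} s² B_s² dφ dz`. -/
def alpha (B : E3 → E3) (s : ℝ) : ℝ :=
  cylInt (fun x => s ^ 2 * sComp B x ^ 2) s

/-- `β(s) = ∫_{C(s)} [2 B_s² + s B · ∇ B_s] s dφ dz`. -/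
def beta (B : E3 → E3) (s : ℝ) : ℝ :=
  cylInt (fun x => (2 * sComp B x ^ 2 + s * fderiv ℝ (sComp B) x (B x)) * s) s

/-- `G(s) = -(1/s) d/ds [ s² ∫_{C(s)} (Cᵃ_φ B_s + Cᵃ_s B_φ) dφ dz ]`. -/
def taylorG (η : ℝ) (B u : E3 → E3) (s : ℝ) : ℝ :=
  -(1 / s) * deriv (fun t => t ^ 2 * cylInt (fun x =>
    phiComp (inductionC η B u) x * sComp B x + sComp (inductionC η B u) x * phiComp B x) t) s

/-- The right side obtained by substituting `Cᵃ` for `∂B/∂t` directly in the time derivative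
of Taylor's integral: `-∫_{C(s)} {[∇ × Cᵃ] × B + [∇ × B] × Cᵃ}_φ s dφ dz`. -/
def taylorGDirect (η : ℝ) (B u : E3 → E3) (s : ℝ) : ℝ :=
  -cylInt (fun x => phiComp (fun y =>
    cross (curl (inductionC η B u) y) (B y) + cross (curl B y) (inductionC η B u y)) x * s) s

/-- `L_T(ug) = α (ug/s)'' + β (ug/s)'`. -/
def taylorL (B : E3 → E3) (ug : ℝ → ℝ) (s : ℝ) : ℝ :=
  alpha B s * deriv (deriv (fun t => ug t / t)) s + beta B s * deriv (fun t => ug t / t) s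

/-- `ug` solves `L_T(ug) = g` on the set `I`. -/
def SolvesTaylor (B : E3 → E3) (g : ℝ → ℝ) (I : Set ℝ) (ug : ℝ → ℝ) : Prop :=
  ∀ s ∈ I, DifferentiableAt ℝ (fun t => ug t / t) s ∧
    DifferentiableAt ℝ (deriv (fun t => ug t / t)) s ∧ taylorL B ug s = g s

/-! ### The dipolar axisymmetric poloidal example -/

/-- The scaling constant. -/
def ampA : ℝ := Real.sqrt (231 / 20584)

/-- The poloidal scalar `A r² (30 r⁴ - 57 r² + 25)`. -/
def dipoleS (r : ℝ) : ℝ := ampA * r ^ 2 * (30 * r ^ 4 - 57 * r ^ 2 + 25)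

/-- `B = ∇ × ∇ × (A r² (30 r⁴ - 57 r² + 25) cos θ r̂)`, with `r̂ = x / ‖x‖`, `cos θ = x₂ / ‖x‖`. -/
def dipoleB : E3 → E3 :=
  curl (curl (fun x => (dipoleS ‖x‖ * (x 2 / ‖x‖)) • (‖x‖⁻¹ • x)))

/-- The azimuthal ageostrophic flow, in cylindrical coordinates. -/
def dipoleUPhi (s z : ℝ) : ℝ :=
  ampA ^ 2 * (9120 * s ^ 7 + (50400 * z ^ 2 - 26184) * s ^ 5
    + (50400 * z ^ 4 - 95760 * z ^ 2 + 23888) * s ^ 3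
    + (16800 * z ^ 6 - 47880 * z ^ 4 + 42000 * z ^ 2 - 6824) * s)

/-- The explicit geostrophic flow, with the constant `C` of solid-body rotation. -/
def dipoleUg (C s : ℝ) : ℝ :=
  ampA ^ 2 * s / 918060 *
    (9926860800 * s ^ 6 - 32213813760 * s ^ 4 + 37855940880 * s ^ 2 + C
      - 11143964160 * Real.log s
      + 30664844 * Real.sqrt 21 * Real.arctan ((80 * s ^ 2 - 73) / Real.sqrt 21)
      + 101695629 * Real.log (640 * s ^ 4 - 1168 * s ^ 2 + 535))

/-- The polynomial `640 X² - 1168 X + 535`. -/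
def polyQ2 : Polynomial ℝ :=
  Polynomial.C 640 * Polynomial.X ^ 2 - Polynomial.C 1168 * Polynomial.X + Polynomial.C 535

end

/-!
The argument rests on the observation that every field in play is axisymmetric with polynomial
coefficients. Writing `ρ = s² = x₀² + x₁²`, a meridional field `polField P R` is
`(x₀ P, x₁ P, R)` and an azimuthal field `torField T` is `(-x₁ T, x₀ T, 0)`, where `P`, `R`, `T` are
functions of `(ρ, z)`. The curl exchanges the two classes (`curl_polField`, `curl_torField`), cross
products respect them, and the Laplacian preserves the meridional class (`laplacian_polField`). In
the definition of the dipolar field the powers of `1/r` cancel, so that it is a polynomial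
meridional field on all of space (`dipoleB_eq`). Its Lorentz force is meridional, hence it is a Taylor
state, and the integrals over columns reduce to integrals of even polynomials in `z`
(`integral_even_polynomial`).

Uniqueness of the ageostrophic flow is a Taylor–Proudman argument (`exists_geostrophic`): for the
difference `v` of two flows `ẑ × v` is a gradient, so the symmetry of the second derivatives of the
pressure, together with incompressibility, gives `∂v/∂z = 0`. Tangency at the two ends of each
column gives `v_z = v_s = 0`, incompressibility then makes `v_φ` a function of `s` only, and the zero
average over columns kills it. Continuity carries the conclusion to the closed ball.

With `Cᵃ = torField indT + η ∇²B`, and `∇²B` meridional, the diffusive part drops out of every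
azimuthal integral. The first-order equation becomes `(u_g/s)' = shearRate s` with an explicit
rational function whose denominator is `s Q₂(s²)`, and its solutions are obtained by checking that the
derivative of the given primitive is `shearRate` (`hasDerivAt_dipoleUg_div`). Substituting
`shearRate` into the second-order operator gives `√(1 - s²) Q₉(s²) / Q₂(s²)`, where `Q₉` is coprime to
`Q₂`. Both right sides of Taylor's equation are `√(1 - s²)` times a polynomial in `s²`, and agreement
on an interval would force `Q₂ ∣ Q₉` (`not_solvesTaylor_of_solvesBWR`).
-/

/-! ### Axisymmetric vector calculus -/

/-- The squared distance `s² = x₀² + x₁²` from the rotation axis. -/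
def axisSq (x : E3) : ℝ := x 0 ^ 2 + x 1 ^ 2

/-- `F : (ρ, z) ↦ F ρ z` is differentiable everywhere, with partial derivatives `Fρ` and `Fz`. -/
def HasPartials (F Fρ Fz : ℝ → ℝ → ℝ) : Prop :=
  ∀ ρ z, HasFDerivAt (fun p : ℝ × ℝ => F p.1 p.2)
    (Fρ ρ z • ContinuousLinearMap.fst ℝ ℝ ℝ + Fz ρ z • ContinuousLinearMap.snd ℝ ℝ ℝ) (ρ, z)

namespace HasPartials

variable {F G Fρ Fz Gρ Gz Fρ' Fz' : ℝ → ℝ → ℝ}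

lemma congr (h : HasPartials F Fρ Fz) (h₁ : ∀ ρ z, Fρ ρ z = Fρ' ρ z) (h₂ : ∀ ρ z, Fz ρ z = Fz' ρ z) :
    HasPartials F Fρ' Fz' := fun ρ z => by
  rw [← h₁, ← h₂]; exact h ρ z

lemma const (c : ℝ) : HasPartials (fun _ _ => c) (fun _ _ => 0) (fun _ _ => 0) := fun ρ z => by
  simpa using hasFDerivAt_const c (ρ, z)

lemma fst : HasPartials (fun ρ _ => ρ) (fun _ _ => 1) (fun _ _ => 0) := fun ρ z => by
  simpa using (hasFDerivAt_fst (𝕜 := ℝ) (p := (ρ, z)))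

lemma snd : HasPartials (fun _ z => z) (fun _ _ => 0) (fun _ _ => 1) := fun ρ z => by
  simpa using (hasFDerivAt_snd (𝕜 := ℝ) (p := (ρ, z)))

lemma add (hF : HasPartials F Fρ Fz) (hG : HasPartials G Gρ Gz) :
    HasPartials (fun ρ z => F ρ z + G ρ z) (fun ρ z => Fρ ρ z + Gρ ρ z)
      (fun ρ z => Fz ρ z + Gz ρ z) := fun ρ z => by
  refine ((hF ρ z).add (hG ρ z)).congr_fderiv ?_
  ext <;> simp

lemma sub (hF : HasPartials F Fρ Fz) (hG : HasPartials G Gρ Gz) :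
    HasPartials (fun ρ z => F ρ z - G ρ z) (fun ρ z => Fρ ρ z - Gρ ρ z)
      (fun ρ z => Fz ρ z - Gz ρ z) := fun ρ z => by
  refine ((hF ρ z).sub (hG ρ z)).congr_fderiv ?_
  ext <;> simp

lemma neg (hF : HasPartials F Fρ Fz) :
    HasPartials (fun ρ z => -F ρ z) (fun ρ z => -Fρ ρ z) (fun ρ z => -Fz ρ z) := fun ρ z => by
  refine (hF ρ z).neg.congr_fderiv ?_
  ext <;> simp

lemma mul (hF : HasPartials F Fρ Fz) (hG : HasPartials G Gρ Gz) :
    HasPartials (fun ρ z => F ρ z * G ρ z) (fun ρ z => Fρ ρ z * G ρ z + F ρ z * Gρ ρ z)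
      (fun ρ z => Fz ρ z * G ρ z + F ρ z * Gz ρ z) := fun ρ z => by
  refine ((hF ρ z).mul (hG ρ z)).congr_fderiv ?_
  ext <;> simp <;> ring

lemma pow (hF : HasPartials F Fρ Fz) (n : ℕ) :
    HasPartials (fun ρ z => F ρ z ^ n) (fun ρ z => n * F ρ z ^ (n - 1) * Fρ ρ z)
      (fun ρ z => n * F ρ z ^ (n - 1) * Fz ρ z) := fun ρ z => by
  refine ((hF ρ z).pow n).congr_fderiv ?_
  ext <;> simp

/-- The chain rule for `x ↦ F (s², z)`. -/
lemma hasFDerivAt_axisym (h : HasPartials F Fρ Fz) (x : E3) :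
    HasFDerivAt (fun y : E3 => F (axisSq y) (y 2))
      ((Fρ (axisSq x) (x 2) * (2 * x 0)) • EuclideanSpace.proj (𝕜 := ℝ) (0 : Fin 3)
        + (Fρ (axisSq x) (x 2) * (2 * x 1)) • EuclideanSpace.proj (𝕜 := ℝ) (1 : Fin 3)
        + Fz (axisSq x) (x 2) • EuclideanSpace.proj (𝕜 := ℝ) (2 : Fin 3)) x := by
  have e (i : Fin 3) : HasFDerivAt (fun y : E3 => y i) (EuclideanSpace.proj (𝕜 := ℝ) i) x :=
    (EuclideanSpace.proj (𝕜 := ℝ) i).hasFDerivAt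
  have hr : HasFDerivAt axisSq _ x := ((e 0).pow 2).add ((e 1).pow 2)
  refine ((h (axisSq x) (x 2)).comp x (hr.prodMk (e 2))).congr_fderiv ?_
  ext v
  simp
  ring

lemma differentiableAt_axisym (h : HasPartials F Fρ Fz) (x : E3) :
    DifferentiableAt ℝ (fun y : E3 => F (axisSq y) (y 2)) x :=
  (h.hasFDerivAt_axisym x).differentiableAt

lemma fderiv_axisym (h : HasPartials F Fρ Fz) (x v : E3) :
    fderiv ℝ (fun y : E3 => F (axisSq y) (y 2)) x v =
      Fρ (axisSq x) (x 2) * (2 * (x 0 * v 0 + x 1 * v 1)) + Fz (axisSq x) (x 2) * v 2 := by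
  rw [(h.hasFDerivAt_axisym x).fderiv]
  simp
  ring

end HasPartials

lemma differentiableAt_coord (i : Fin 3) (x : E3) : DifferentiableAt ℝ (fun y : E3 => y i) x :=
  (EuclideanSpace.proj (𝕜 := ℝ) i).differentiableAt

lemma fderiv_coord (i : Fin 3) (x v : E3) : fderiv ℝ (fun y : E3 => y i) x v = v i := by
  rw [show (fun y : E3 => y i) = EuclideanSpace.proj (𝕜 := ℝ) i from rfl,
    ContinuousLinearMap.fderiv]
  rfl

lemma partialD_coord_mul (i k : Fin 3) {f : E3 → ℝ} {x : E3} (hf : DifferentiableAt ℝ f x) :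
    partialD i (fun y => y k * f y) x = (if k = i then f x else 0) + x k * partialD i f x := by
  have := fderiv_fun_mul (differentiableAt_coord k x) hf
  rw [partialD, this]
  simp [partialD, fderiv_coord]
  ring

lemma partialD_axisym {F Fρ Fz : ℝ → ℝ → ℝ} (h : HasPartials F Fρ Fz) (i : Fin 3) (x : E3) :
    partialD i (fun y : E3 => F (axisSq y) (y 2)) x =
      ![2 * x 0 * Fρ (axisSq x) (x 2), 2 * x 1 * Fρ (axisSq x) (x 2), Fz (axisSq x) (x 2)] i := by
  rw [partialD, h.fderiv_axisym]
  fin_cases i <;> simp <;> ring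

lemma partialD_neg (i : Fin 3) (f : E3 → ℝ) (x : E3) :
    partialD i (fun y => -f y) x = -partialD i f x := by
  simp [partialD, fderiv_fun_neg]

lemma partialD_const (i : Fin 3) (c : ℝ) (x : E3) : partialD i (fun _ => c) x = 0 := by
  simp [partialD]

/-- The meridional (poloidal) axisymmetric field with `F_s = s P(s², z)` and `F_z = R(s², z)`. -/
def polField (P R : ℝ → ℝ → ℝ) (x : E3) : E3 :=
  !₂[x 0 * P (axisSq x) (x 2), x 1 * P (axisSq x) (x 2), R (axisSq x) (x 2)]

/-- The azimuthal (toroidal) axisymmetric field with `F_φ = s T(s², z)`. -/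
def torField (T : ℝ → ℝ → ℝ) (x : E3) : E3 :=
  !₂[-(x 1 * T (axisSq x) (x 2)), x 0 * T (axisSq x) (x 2), 0]

section
variable {P Pρ Pz R Rρ Rz T Tρ Tz : ℝ → ℝ → ℝ}

lemma curl_polField (hP : HasPartials P Pρ Pz) (hR : HasPartials R Rρ Rz) :
    curl (polField P R) = torField (fun ρ z => Pz ρ z - 2 * Rρ ρ z) := by
  ext x i
  have d := hP.differentiableAt_axisym x
  fin_cases i <;>
  simp [curl, polField, torField, partialD_coord_mul _ _ d, partialD_axisym hP, partialD_axisym hR]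
    <;> ring

lemma curl_torField (hT : HasPartials T Tρ Tz) :
    curl (torField T) =
      polField (fun ρ z => -Tz ρ z) (fun ρ z => 2 * T ρ z + 2 * ρ * Tρ ρ z) := by
  ext x i
  have d := hT.differentiableAt_axisym x
  fin_cases i <;>
  simp [curl, polField, torField, partialD_coord_mul _ _ d, partialD_axisym hT, partialD_neg,
    partialD_const]
  rw [axisSq]
  ring

lemma divergence_torField (hT : HasPartials T Tρ Tz) (x : E3) : divergence (torField T) x = 0 := by
  have d := hT.differentiableAt_axisym x
  simp [divergence, Fin.sum_univ_three, torField, partialD_coord_mul _ _ d, partialD_axisym hT,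
    partialD_neg, partialD_const]
  ring

lemma curl_add {F G : E3 → E3} {x : E3} (hF : DifferentiableAt ℝ F x) (hG : DifferentiableAt ℝ G x) :
    curl (fun y => F y + G y) x = curl F x + curl G x := by
  have hF' := (differentiableAt_piLp 2).1 hF
  have hG' := (differentiableAt_piLp 2).1 hG
  ext i
  fin_cases i <;> simp [curl, partialD, fderiv_fun_add (hF' _) (hG' _)] <;> ring

lemma partialD_const_mul (i : Fin 3) (c : ℝ) (f : E3 → ℝ) (x : E3) :
    partialD i (fun y => c * f y) x = c * partialD i f x := by
  have := congrFun (fderiv_const_smul_field (𝕜 := ℝ) (f := f) c) x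
  rw [partialD, show (fun y => c * f y) = c • f from rfl, this]
  simp [partialD]

lemma curl_const_smul (c : ℝ) (F : E3 → E3) (x : E3) :
    curl (fun y => c • F y) x = c • curl F x := by
  ext i
  fin_cases i <;> simp [curl, partialD_const_mul] <;> ring

lemma curl_congr {F G : E3 → E3} {x : E3} (h : F =ᶠ[nhds x] G) : curl F x = curl G x := by
  have e (i : Fin 3) : (fun y => F y i) =ᶠ[nhds x] fun y => G y i := h.mono fun y hy => by
    simp only [hy]
  simp only [curl, partialD, (e _).fderiv_eq]

lemma cross_tor_pol (x : E3) :
    cross (torField T x) (polField P R x) =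
      polField (fun ρ z => T ρ z * R ρ z) (fun ρ z => -(ρ * T ρ z * P ρ z)) x := by
  ext i
  fin_cases i <;> simp [cross, torField, polField, crossProduct, axisSq] <;> ring

lemma cross_pol_pol (P R P' R' : ℝ → ℝ → ℝ) (x : E3) :
    cross (polField P R x) (polField P' R' x) =
      torField (fun ρ z => R ρ z * P' ρ z - P ρ z * R' ρ z) x := by
  ext i
  fin_cases i <;> simp [cross, torField, polField, crossProduct] <;> ring

lemma cross_tor_tor (T T' : ℝ → ℝ → ℝ) (x : E3) : cross (torField T x) (torField T' x) = 0 := by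
  ext i
  fin_cases i <;> simp [cross, torField, crossProduct]
  ring

lemma cross_add_left (u v w : E3) : cross (u + v) w = cross u w + cross v w := by
  simp [cross]

lemma cross_add_right (u v w : E3) : cross u (v + w) = cross u v + cross u w := by
  simp [cross]

lemma cross_smul_left (c : ℝ) (u v : E3) : cross (c • u) v = c • cross u v := by
  simp [cross]

lemma cross_smul_right (c : ℝ) (u v : E3) : cross u (c • v) = c • cross u v := by
  simp [cross]

lemma differentiable_polField (hP : HasPartials P Pρ Pz) (hR : HasPartials R Rρ Rz) :
    Differentiable ℝ (polField P R) := fun x => (differentiableAt_piLp 2).2 fun i => by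
  have h := hP.differentiableAt_axisym x
  fin_cases i
  · exact (differentiableAt_coord 0 x).fun_mul h
  · exact (differentiableAt_coord 1 x).fun_mul h
  · exact hR.differentiableAt_axisym x

lemma differentiable_torField (hT : HasPartials T Tρ Tz) :
    Differentiable ℝ (torField T) := fun x => (differentiableAt_piLp 2).2 fun i => by
  have h := hT.differentiableAt_axisym x
  fin_cases i
  · exact ((differentiableAt_coord 1 x).fun_mul h).fun_neg
  · exact (differentiableAt_coord 0 x).fun_mul h
  · exact differentiableAt_const _

lemma contDiff_axisym {n : WithTop ℕ∞} (hT : ContDiff ℝ n fun p : ℝ × ℝ => T p.1 p.2) :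
    ContDiff ℝ n fun x : E3 => T (axisSq x) (x 2) := by
  have : ContDiff ℝ n fun x : E3 => (axisSq x, x 2) := by unfold axisSq; fun_prop
  exact hT.comp this

lemma contDiff_coord {n : WithTop ℕ∞} (i : Fin 3) : ContDiff ℝ n fun x : E3 => x i :=
  (EuclideanSpace.proj (𝕜 := ℝ) i).contDiff

lemma contDiff_torField {n : WithTop ℕ∞} (hT : ContDiff ℝ n fun p : ℝ × ℝ => T p.1 p.2) :
    ContDiff ℝ n (torField T) := (contDiff_piLp 2).2 fun i => by
  have h := contDiff_axisym hT
  fin_cases i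
  · exact ((contDiff_coord 1).mul h).neg
  · exact (contDiff_coord 0).mul h
  · exact contDiff_const

lemma contDiff_polField {n : WithTop ℕ∞} (hP : ContDiff ℝ n fun p : ℝ × ℝ => P p.1 p.2)
    (hR : ContDiff ℝ n fun p : ℝ × ℝ => R p.1 p.2) :
    ContDiff ℝ n (polField P R) := (contDiff_piLp 2).2 fun i => by
  have h := contDiff_axisym hP
  fin_cases i
  · exact (contDiff_coord 0).mul h
  · exact (contDiff_coord 1).mul h
  · exact contDiff_axisym hR

end

/-- The Laplacian of a vector field is computed in Cartesian components. -/
lemma laplacian_apply_eq_sum {F : E3 → E3} (hF : ContDiff ℝ 2 F) (x : E3) (k : Fin 3) :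
    Laplacian.laplacian F x k =
      ∑ i : Fin 3, partialD i (fun y => partialD i (fun w => F w k) y) x := by
  have h1 := hF.contDiffAt.laplacian_CLM_comp_left (x := x)
    (l := (EuclideanSpace.proj (𝕜 := ℝ) k : E3 →L[ℝ] ℝ))
  have hk : ContDiff ℝ 2 fun w => F w k := by fun_prop
  have h2 : Laplacian.laplacian F x k = Laplacian.laplacian (fun w => F w k) x := by
    simpa [Function.comp_def] using h1.symm
  rw [h2, InnerProductSpace.laplacian_eq_iteratedFDeriv_orthonormalBasis _
    (EuclideanSpace.basisFun (Fin 3) ℝ)]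
  refine Finset.sum_congr rfl fun i _ => ?_
  rw [iteratedFDeriv_two_apply]
  have hd : DifferentiableAt ℝ (fderiv ℝ fun w => F w k) x :=
    (hk.fderiv_right (m := 1) (by norm_num)).differentiable (by norm_num) x
  unfold partialD
  rw [fderiv_clm_apply hd (differentiableAt_const _)]
  simp

lemma partialD_add (i : Fin 3) {f g : E3 → ℝ} {x : E3} (hf : DifferentiableAt ℝ f x)
    (hg : DifferentiableAt ℝ g x) :
    partialD i (fun y => f y + g y) x = partialD i f x + partialD i g x := by
  rw [partialD, fderiv_fun_add hf hg]
  simp [partialD]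

section
variable {F Fρ Fz Fρρ Fρz Fzρ Fzz : ℝ → ℝ → ℝ}

lemma differentiable_partialD_axisym (hF : HasPartials F Fρ Fz) (hFρ : HasPartials Fρ Fρρ Fρz)
    (hFz : HasPartials Fz Fzρ Fzz) (i : Fin 3) :
    Differentiable ℝ (partialD i fun w => F (axisSq w) (w 2)) := fun y => by
  have e : (partialD i fun w => F (axisSq w) (w 2)) = _ := funext (partialD_axisym hF i)
  rw [e]
  have h1 := hFρ.differentiableAt_axisym y
  have h2 := hFz.differentiableAt_axisym y
  have h3 (k) := differentiableAt_coord k y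
  fin_cases i
  · exact ((h3 0).const_mul 2).mul h1
  · exact ((h3 1).const_mul 2).mul h1
  · exact h2

lemma partialD_partialD_axisym (hF : HasPartials F Fρ Fz) (hFρ : HasPartials Fρ Fρρ Fρz)
    (hFz : HasPartials Fz Fzρ Fzz) (i : Fin 3) (x : E3) :
    partialD i (partialD i fun w => F (axisSq w) (w 2)) x =
      ![2 * Fρ (axisSq x) (x 2) + 4 * x 0 ^ 2 * Fρρ (axisSq x) (x 2),
        2 * Fρ (axisSq x) (x 2) + 4 * x 1 ^ 2 * Fρρ (axisSq x) (x 2), Fzz (axisSq x) (x 2)] i := by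
  have e : (partialD i fun w => F (axisSq w) (w 2)) = _ := funext (partialD_axisym hF i)
  rw [e]
  have d := (hFρ.differentiableAt_axisym x).const_mul 2
  have e' (k : Fin 3) : (fun y : E3 => 2 * y k * Fρ (axisSq y) (y 2)) =
    fun y => y k * (2 * Fρ (axisSq y) (y 2)) := by ext; ring
  fin_cases i
  · simp [e', partialD_coord_mul _ _ d, partialD_const_mul, partialD_axisym hFρ]
    ring
  · simp [e', partialD_coord_mul _ _ d, partialD_const_mul, partialD_axisym hFρ]
    ring
  · simp [partialD_axisym hFz]

lemma partialD_partialD_coord_mul_axisym (hF : HasPartials F Fρ Fz) (hFρ : HasPartials Fρ Fρρ Fρz)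
    (hFz : HasPartials Fz Fzρ Fzz) (k i : Fin 3) (x : E3) :
    partialD i (partialD i fun w => w k * F (axisSq w) (w 2)) x =
      (if k = i then 2 * partialD i (fun w => F (axisSq w) (w 2)) x else 0) +
        x k * partialD i (partialD i fun w => F (axisSq w) (w 2)) x := by
  have d := hF.differentiableAt_axisym
  have d' := differentiable_partialD_axisym hF hFρ hFz i x
  have e : (partialD i fun w => w k * F (axisSq w) (w 2)) = _ :=
    funext fun y => partialD_coord_mul i k (d y)
  rw [e]
  split_ifs with h
  · rw [partialD_add _ (d x) ((differentiableAt_coord k x).fun_mul d'), partialD_coord_mul _ _ d',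
      if_pos h]
    ring
  · simp only [zero_add]
    rw [partialD_coord_mul _ _ d', if_neg h, zero_add]

end

/-- The Laplacian of a meridional axisymmetric field is again meridional and axisymmetric. -/
lemma laplacian_polField {P Pρ Pz Pρρ Pρz Pzρ Pzz R Rρ Rz Rρρ Rρz Rzρ Rzz : ℝ → ℝ → ℝ}
    (cP : ContDiff ℝ 2 fun p : ℝ × ℝ => P p.1 p.2) (cR : ContDiff ℝ 2 fun p : ℝ × ℝ => R p.1 p.2)
    (hP : HasPartials P Pρ Pz) (hPρ : HasPartials Pρ Pρρ Pρz) (hPz : HasPartials Pz Pzρ Pzz)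
    (hR : HasPartials R Rρ Rz) (hRρ : HasPartials Rρ Rρρ Rρz) (hRz : HasPartials Rz Rzρ Rzz) :
    Laplacian.laplacian (polField P R) =
      polField (fun ρ z => 8 * Pρ ρ z + 4 * ρ * Pρρ ρ z + Pzz ρ z)
        (fun ρ z => 4 * Rρ ρ z + 4 * ρ * Rρρ ρ z + Rzz ρ z) := by
  ext x k
  rw [laplacian_apply_eq_sum (contDiff_polField cP cR)]
  fin_cases k
  · simp [polField, partialD_partialD_coord_mul_axisym hP hPρ hPz,
      partialD_partialD_axisym hP hPρ hPz, partialD_axisym hP, Fin.sum_univ_three]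
    simp [axisSq]
    ring
  · simp [polField, partialD_partialD_coord_mul_axisym hP hPρ hPz,
      partialD_partialD_axisym hP hPρ hPz, partialD_axisym hP, Fin.sum_univ_three]
    simp [axisSq]
    ring
  · simp [polField, partialD_partialD_axisym hR hRρ hRz, Fin.sum_univ_three]
    simp [axisSq]
    ring

/-! ### The dipolar field, its ageostrophic flow and the induction term -/

/-- `B_s / s` for the dipolar field, as a function of `s²` and `z`. -/
noncomputable def magP (ρ z : ℝ) : ℝ := ampA * (-120 * ρ * z - 120 * z ^ 3 + 114 * z)

/-- `B_z` for the dipolar field, as a function of `s²` and `z`. -/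
noncomputable def magR (ρ z : ℝ) : ℝ :=
  ampA * (180 * ρ ^ 2 + 240 * ρ * z ^ 2 - 228 * ρ + 60 * z ^ 4 - 114 * z ^ 2 + 50)

/-- `(∇ × B)_φ / s` for the dipolar field, as a function of `s²` and `z`. -/
noncomputable def curJ (ρ z : ℝ) : ℝ := ampA * (-840 * ρ - 840 * z ^ 2 + 570)

/-- `u_φ / s` for the ageostrophic flow, as a function of `s²` and `z`. -/
noncomputable def flowT (ρ z : ℝ) : ℝ :=
  ampA ^ 2 * (9120 * ρ ^ 3 + 50400 * ρ ^ 2 * z ^ 2 - 26184 * ρ ^ 2 + 50400 * ρ * z ^ 4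
    - 95760 * ρ * z ^ 2 + 23888 * ρ + 16800 * z ^ 6 - 47880 * z ^ 4 + 42000 * z ^ 2 - 6824)

/-- The pressure that balances the ageostrophic flow, as a function of `s²` and `z`. -/
noncomputable def pressureF (ρ z : ℝ) : ℝ :=
  ampA ^ 2 * (-17760 * ρ ^ 4 - 50400 * ρ ^ 3 * z ^ 2 + 44656 * ρ ^ 3 - 50400 * ρ ^ 2 * z ^ 4
    + 82080 * ρ ^ 2 * z ^ 2 - 37018 * ρ ^ 2 - 16800 * ρ * z ^ 6 + 41040 * ρ * z ^ 4
    - 32490 * ρ * z ^ 2 + 10838 * ρ)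

/-- `[∇ × (u × B)]_φ / s` for the ageostrophic flow, as a function of `s²` and `z`. -/
noncomputable def indT (ρ z : ℝ) : ℝ :=
  ampA ^ 3 * (11577600 * ρ ^ 4 * z + 29721600 * ρ ^ 3 * z ^ 3 - 38649600 * ρ ^ 3 * z
    + 36288000 * ρ ^ 2 * z ^ 5 - 79361280 * ρ ^ 2 * z ^ 3 + 46153536 * ρ ^ 2 * z
    + 24192000 * ρ * z ^ 7 - 68947200 * ρ * z ^ 5 + 68173440 * ρ * z ^ 3 - 23281536 * ρ * z
    + 6048000 * z ^ 9 - 22982400 * z ^ 7 + 31913280 * z ^ 5 - 19152000 * z ^ 3 + 4200000 * z)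

/-- `∂(indT)/∂ρ`. -/
noncomputable def indTρ (ρ z : ℝ) : ℝ :=
  ampA ^ 3 * (46310400 * ρ ^ 3 * z + 89164800 * ρ ^ 2 * z ^ 3 - 115948800 * ρ ^ 2 * z
    + 72576000 * ρ * z ^ 5 - 158722560 * ρ * z ^ 3 + 92307072 * ρ * z + 24192000 * z ^ 7
    - 68947200 * z ^ 5 + 68173440 * z ^ 3 - 23281536 * z)

/-- `∂(indT)/∂z`. -/
noncomputable def indTz (ρ z : ℝ) : ℝ :=
  ampA ^ 3 * (11577600 * ρ ^ 4 + 89164800 * ρ ^ 3 * z ^ 2 - 38649600 * ρ ^ 3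
    + 181440000 * ρ ^ 2 * z ^ 4 - 238083840 * ρ ^ 2 * z ^ 2 + 46153536 * ρ ^ 2
    + 169344000 * ρ * z ^ 6 - 344736000 * ρ * z ^ 4 + 204520320 * ρ * z ^ 2 - 23281536 * ρ
    + 54432000 * z ^ 8 - 160876800 * z ^ 6 + 159566400 * z ^ 4 - 57456000 * z ^ 2 + 4200000)

lemma hasPartials_magP : HasPartials magP (fun _ z => ampA * (-120 * z))
    (fun ρ z => ampA * (-120 * ρ - 360 * z ^ 2 + 114)) := by
  unfold magP
  -- the closure rules produce the derivatives of any explicit polynomial; `ring` normalises them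
  apply HasPartials.congr
  · repeat'
      with_reducible first
        | exact HasPartials.const _ | exact HasPartials.fst | exact HasPartials.snd
        | apply HasPartials.add | apply HasPartials.sub | apply HasPartials.neg
        | apply HasPartials.mul | apply HasPartials.pow
  all_goals intro ρ z; simp only [Nat.cast_ofNat, Nat.reduceSub]; ring

lemma hasPartials_magR : HasPartials magR (fun ρ z => ampA * (360 * ρ + 240 * z ^ 2 - 228))
    (fun ρ z => ampA * (480 * ρ * z + 240 * z ^ 3 - 228 * z)) := by
  unfold magR
  apply HasPartials.congr
  · repeat'
      with_reducible first
        | exact HasPartials.const _ | exact HasPartials.fst | exact HasPartials.snd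
        | apply HasPartials.add | apply HasPartials.sub | apply HasPartials.neg
        | apply HasPartials.mul | apply HasPartials.pow
  all_goals intro ρ z; simp only [Nat.cast_ofNat, Nat.reduceSub]; ring

lemma hasPartials_flowT : HasPartials flowT
    (fun ρ z => ampA ^ 2 * (27360 * ρ ^ 2 + 100800 * ρ * z ^ 2 - 52368 * ρ + 50400 * z ^ 4
      - 95760 * z ^ 2 + 23888))
    (fun ρ z => ampA ^ 2 * (100800 * ρ ^ 2 * z + 201600 * ρ * z ^ 3 - 191520 * ρ * z
      + 100800 * z ^ 5 - 191520 * z ^ 3 + 84000 * z)) := by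
  unfold flowT
  apply HasPartials.congr
  · repeat'
      with_reducible first
        | exact HasPartials.const _ | exact HasPartials.fst | exact HasPartials.snd
        | apply HasPartials.add | apply HasPartials.sub | apply HasPartials.neg
        | apply HasPartials.mul | apply HasPartials.pow
  all_goals intro ρ z; simp only [Nat.cast_ofNat, Nat.reduceSub]; ring

lemma hasPartials_pressureF : HasPartials pressureF
    (fun ρ z => (curJ ρ z * magR ρ z + flowT ρ z) / 2) (fun ρ z => -(ρ * curJ ρ z * magP ρ z)) := by
  unfold pressureF
  apply HasPartials.congr
  · repeat'
      with_reducible first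
        | exact HasPartials.const _ | exact HasPartials.fst | exact HasPartials.snd
        | apply HasPartials.add | apply HasPartials.sub | apply HasPartials.neg
        | apply HasPartials.mul | apply HasPartials.pow
  all_goals intro ρ z; simp only [curJ, magP, magR, flowT, Nat.cast_ofNat, Nat.reduceSub]; ring

lemma hasPartials_indT : HasPartials indT indTρ indTz := by
  unfold indT
  apply HasPartials.congr
  · repeat'
      with_reducible first
        | exact HasPartials.const _ | exact HasPartials.fst | exact HasPartials.snd
        | apply HasPartials.add | apply HasPartials.sub | apply HasPartials.neg
        | apply HasPartials.mul | apply HasPartials.pow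
  · intro ρ z; unfold indTρ; simp only [Nat.cast_ofNat, Nat.reduceSub]; ring
  · intro ρ z; unfold indTz; simp only [Nat.cast_ofNat, Nat.reduceSub]; ring

lemma norm_sq_eq_axisSq (x : E3) : ‖x‖ ^ 2 = axisSq x + x 2 ^ 2 := by
  rw [EuclideanSpace.real_norm_sq_eq, Fin.sum_univ_three, axisSq]

/-- The vector potential `∇ × (S(r) cos θ r̂)` generates the dipolar field; the singular factors
`1/r` cancel, and all fields are polynomial. -/
lemma dipolePotential_eq :
    (fun x : E3 => (dipoleS ‖x‖ * (x 2 / ‖x‖)) • (‖x‖⁻¹ • x)) =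
      polField (fun ρ z => z * (ampA * (30 * (ρ + z ^ 2) ^ 2 - 57 * (ρ + z ^ 2) + 25)))
        (fun ρ z => z ^ 2 * (ampA * (30 * (ρ + z ^ 2) ^ 2 - 57 * (ρ + z ^ 2) + 25))) := by
  ext x i
  rcases eq_or_ne x 0 with rfl | hx
  · fin_cases i <;> simp [polField]
  have hn : ‖x‖ ≠ 0 := norm_ne_zero_iff.2 hx
  have key : (dipoleS ‖x‖ * (x 2 / ‖x‖)) * ‖x‖⁻¹ =
      x 2 * (ampA * (30 * (axisSq x + x 2 ^ 2) ^ 2 - 57 * (axisSq x + x 2 ^ 2) + 25)) := by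
    rw [← norm_sq_eq_axisSq, dipoleS]
    field_simp
  rw [smul_smul, key]
  fin_cases i <;> simp [polField] <;> ring

lemma hasPartials_potential (n : ℕ) :
    HasPartials (fun ρ z => z ^ n * (ampA * (30 * (ρ + z ^ 2) ^ 2 - 57 * (ρ + z ^ 2) + 25)))
      (fun ρ z => z ^ n * (ampA * (60 * (ρ + z ^ 2) - 57)))
      (fun ρ z => n * z ^ (n - 1) * (ampA * (30 * (ρ + z ^ 2) ^ 2 - 57 * (ρ + z ^ 2) + 25))
        + z ^ n * (ampA * (120 * (ρ + z ^ 2) * z - 114 * z))) := by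
  apply HasPartials.congr
  · repeat'
      with_reducible first
        | exact HasPartials.const _ | exact HasPartials.fst | exact HasPartials.snd
        | apply HasPartials.add | apply HasPartials.sub | apply HasPartials.neg
        | apply HasPartials.mul | apply HasPartials.pow
  all_goals intro ρ z; simp only [Nat.cast_ofNat, Nat.reduceSub]; ring

lemma dipoleB_eq : dipoleB = polField magP magR := by
  have h0 := hasPartials_potential 0
  have h1 := hasPartials_potential 1
  have h2 := hasPartials_potential 2
  simp only [pow_one, pow_zero, one_mul] at h0 h1
  rw [dipoleB, dipolePotential_eq, curl_polField h1 h2]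
  refine (congrArg (fun T => curl (torField T)) (?_ : _ = fun ρ z : ℝ =>
    ampA * (30 * (ρ + z ^ 2) ^ 2 - 57 * (ρ + z ^ 2) + 25))).trans ?_
  · ext ρ z; simp; ring
  rw [curl_torField h0]
  congr 1 <;> ext ρ z
  · simp [magP]; ring
  · simp [magR]; ring

lemma curl_dipoleB : curl dipoleB = torField curJ := by
  rw [dipoleB_eq, curl_polField hasPartials_magP hasPartials_magR]
  congr 1; ext ρ z; simp only [curJ]; ring

lemma lorentz_dipoleB (x : E3) : lorentz dipoleB x =
    polField (fun ρ z => curJ ρ z * magR ρ z) (fun ρ z => -(ρ * curJ ρ z * magP ρ z)) x := by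
  rw [lorentz, curl_dipoleB, dipoleB_eq, cross_tor_pol]

lemma laplacian_dipoleB : Laplacian.laplacian dipoleB =
    polField (fun _ z => ampA * (-1680 * z))
      (fun ρ z => ampA * (3360 * ρ + 1680 * z ^ 2 - 1140)) := by
  have h1 : HasPartials (fun _ z => ampA * (-120 * z)) (fun _ _ => 0) (fun _ _ => -120 * ampA) := by
    apply HasPartials.congr
    · repeat'
        with_reducible first
          | exact HasPartials.const _ | exact HasPartials.fst | exact HasPartials.snd
          | apply HasPartials.mul
    all_goals intro ρ z; ring
  have h2 : HasPartials (fun ρ z => ampA * (-120 * ρ - 360 * z ^ 2 + 114)) (fun _ _ => -120 * ampA)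
      (fun _ z => ampA * (-720 * z)) := by
    apply HasPartials.congr
    · repeat'
        with_reducible first
          | exact HasPartials.const _ | exact HasPartials.fst | exact HasPartials.snd
          | apply HasPartials.add | apply HasPartials.sub | apply HasPartials.mul
          | apply HasPartials.pow
    all_goals intro ρ z; simp only [Nat.cast_ofNat, Nat.reduceSub]; ring
  have h3 : HasPartials (fun ρ z => ampA * (360 * ρ + 240 * z ^ 2 - 228)) (fun _ _ => 360 * ampA)
      (fun _ z => ampA * (480 * z)) := by
    apply HasPartials.congr
    · repeat'
        with_reducible first
          | exact HasPartials.const _ | exact HasPartials.fst | exact HasPartials.snd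
          | apply HasPartials.add | apply HasPartials.sub | apply HasPartials.mul
          | apply HasPartials.pow
    all_goals intro ρ z; simp only [Nat.cast_ofNat, Nat.reduceSub]; ring
  have h4 : HasPartials (fun ρ z => ampA * (480 * ρ * z + 240 * z ^ 3 - 228 * z))
      (fun _ z => ampA * (480 * z)) (fun ρ z => ampA * (480 * ρ + 720 * z ^ 2 - 228)) := by
    apply HasPartials.congr
    · repeat'
        with_reducible first
          | exact HasPartials.const _ | exact HasPartials.fst | exact HasPartials.snd
          | apply HasPartials.add | apply HasPartials.sub | apply HasPartials.mul
          | apply HasPartials.pow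
    all_goals intro ρ z; simp only [Nat.cast_ofNat, Nat.reduceSub]; ring
  rw [dipoleB_eq, laplacian_polField (by unfold magP; fun_prop) (by unfold magR; fun_prop)
    hasPartials_magP h1 h2 hasPartials_magR h3 h4]
  congr 1 <;> ext ρ z <;> ring

lemma hasPartials_laplacianP : HasPartials (fun _ z => ampA * (-1680 * z)) (fun _ _ => 0)
    (fun _ _ => -1680 * ampA) := by
  apply HasPartials.congr
  · repeat'
      with_reducible first
        | exact HasPartials.const _ | exact HasPartials.fst | exact HasPartials.snd
        | apply HasPartials.mul
  all_goals intro ρ z; ring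

lemma hasPartials_laplacianR : HasPartials (fun ρ z => ampA * (3360 * ρ + 1680 * z ^ 2 - 1140))
    (fun _ _ => 3360 * ampA) (fun _ z => ampA * (3360 * z)) := by
  apply HasPartials.congr
  · repeat'
      with_reducible first
        | exact HasPartials.const _ | exact HasPartials.fst | exact HasPartials.snd
        | apply HasPartials.add | apply HasPartials.sub | apply HasPartials.mul
        | apply HasPartials.pow
  all_goals intro ρ z; simp only [Nat.cast_ofNat, Nat.reduceSub]; ring

/-- `∇ × (u × B)` is azimuthal for the azimuthal flow and the meridional field. -/
lemma curl_flow_cross_dipoleB :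
    curl (fun y => cross (torField flowT y) (dipoleB y)) = torField indT := by
  have h1 := hasPartials_flowT.mul hasPartials_magR
  have h2 := ((HasPartials.fst.mul hasPartials_flowT).mul hasPartials_magP).neg
  rw [dipoleB_eq, show (fun y => cross (torField flowT y) (polField magP magR y)) =
    polField _ _ from funext cross_tor_pol, curl_polField h1 h2]
  congr 1; ext ρ z; simp only [flowT, magP, magR, indT]; ring

section
variable {u : E3 → E3}

/-- Inside the ball, `Cᵃ` is the sum of an azimuthal field and the meridional field `η ∇²B`. -/
lemma inductionC_eq (η : ℝ) (hu : ∀ x ∈ Metric.ball (0 : E3) 1, u x = torField flowT x) {x : E3}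
    (hx : x ∈ Metric.ball (0 : E3) 1) :
    inductionC η dipoleB u x = torField indT x + η • polField (fun _ z => ampA * (-1680 * z))
      (fun ρ z => ampA * (3360 * ρ + 1680 * z ^ 2 - 1140)) x := by
  have e : (fun y => cross (u y) (dipoleB y)) =ᶠ[nhds x]
      fun y => cross (torField flowT y) (dipoleB y) := by
    filter_upwards [Metric.isOpen_ball.mem_nhds hx] with y hy
    rw [hu y hy]
  rw [inductionC, curl_congr e, curl_flow_cross_dipoleB, laplacian_dipoleB]

lemma curl_inductionC_eq (η : ℝ) (hu : ∀ x ∈ Metric.ball (0 : E3) 1, u x = torField flowT x)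
    {x : E3} (hx : x ∈ Metric.ball (0 : E3) 1) :
    curl (inductionC η dipoleB u) x =
      polField (fun ρ z => -indTz ρ z) (fun ρ z => 2 * indT ρ z + 2 * ρ * indTρ ρ z) x
        + η • torField (fun _ _ => -8400 * ampA) x := by
  have e : inductionC η dipoleB u =ᶠ[nhds x] fun y => torField indT y +
      η • polField (fun _ z => ampA * (-1680 * z))
        (fun ρ z => ampA * (3360 * ρ + 1680 * z ^ 2 - 1140)) y := by
    filter_upwards [Metric.isOpen_ball.mem_nhds hx] with y hy
    exact inductionC_eq η hu hy
  rw [curl_congr e, curl_add (differentiable_torField hasPartials_indT x)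
    ((differentiable_polField hasPartials_laplacianP hasPartials_laplacianR x).fun_const_smul η),
    curl_const_smul, curl_torField hasPartials_indT,
    curl_polField hasPartials_laplacianP hasPartials_laplacianR]
  congr 3; ext ρ z; ring

end

/-! ### Cylindrical coordinates in the ball -/

lemma axisSq_cylPt (s φ z : ℝ) : axisSq (cylPt s φ z) = s ^ 2 := by
  simp only [axisSq, cylPt, PiLp.toLp_apply, Matrix.cons_val_zero, Matrix.cons_val_one]
  linear_combination s ^ 2 * Real.sin_sq_add_cos_sq φ

lemma cylPt_two (s φ z : ℝ) : cylPt s φ z 2 = z := rfl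

lemma norm_sq_cylPt (s φ z : ℝ) : ‖cylPt s φ z‖ ^ 2 = s ^ 2 + z ^ 2 := by
  rw [norm_sq_eq_axisSq, axisSq_cylPt, cylPt_two]

lemma exists_eq_cylPt (x : E3) : ∃ s φ z : ℝ, 0 ≤ s ∧ x = cylPt s φ z := by
  let w : ℂ := ⟨x 0, x 1⟩
  refine ⟨‖w‖, w.arg, x 2, norm_nonneg _, ?_⟩
  ext i
  fin_cases i
  · simp [cylPt, w]
  · simp [cylPt, w]
  · simp [cylPt]

lemma cylPt_mem_closedBall {s φ z : ℝ} :
    cylPt s φ z ∈ Metric.closedBall (0 : E3) 1 ↔ s ^ 2 + z ^ 2 ≤ 1 := by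
  rw [mem_closedBall_zero_iff, ← norm_sq_cylPt s φ z, sq_le_one_iff₀ (norm_nonneg _)]

lemma cylPt_mem_ball {s φ z : ℝ} :
    cylPt s φ z ∈ Metric.ball (0 : E3) 1 ↔ s ^ 2 + z ^ 2 < 1 := by
  rw [mem_ball_zero_iff, ← norm_sq_cylPt s φ z, sq_lt_one_iff₀ (norm_nonneg _)]

lemma sq_lt_of_mem_Ioo_sqrt {s z : ℝ}
    (hz : z ∈ Set.Ioo (-Real.sqrt (1 - s ^ 2)) (Real.sqrt (1 - s ^ 2))) : s ^ 2 + z ^ 2 < 1 := by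
  have := Real.sq_lt.2 ⟨hz.1, hz.2⟩
  linarith

lemma torField_cylPt (T : ℝ → ℝ → ℝ) (s φ z : ℝ) :
    torField T (cylPt s φ z) = (s * T (s ^ 2) z) • ePhi φ := by
  ext i
  simp only [torField, axisSq_cylPt, cylPt_two]
  fin_cases i <;> simp [cylPt, ePhi] <;> ring

lemma phiComp_cylPt {F : E3 → E3} {P R T : ℝ → ℝ → ℝ} {s φ z : ℝ} (hs : 0 < s)
    (hF : F (cylPt s φ z) = polField P R (cylPt s φ z) + torField T (cylPt s φ z)) :
    phiComp F (cylPt s φ z) = s * T (s ^ 2) z := by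
  have h : cylPt s φ z 0 ^ 2 + cylPt s φ z 1 ^ 2 = s ^ 2 := axisSq_cylPt s φ z
  rw [phiComp, h, Real.sqrt_sq hs.le, hF]
  simp only [torField, polField, axisSq_cylPt, PiLp.add_apply]
  simp [cylPt]
  field_simp
  linear_combination T (s ^ 2) z * Real.sin_sq_add_cos_sq φ

lemma sComp_cylPt {F : E3 → E3} {P R T : ℝ → ℝ → ℝ} {s φ z : ℝ} (hs : 0 < s)
    (hF : F (cylPt s φ z) = polField P R (cylPt s φ z) + torField T (cylPt s φ z)) :
    sComp F (cylPt s φ z) = s * P (s ^ 2) z := by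
  have h : cylPt s φ z 0 ^ 2 + cylPt s φ z 1 ^ 2 = s ^ 2 := axisSq_cylPt s φ z
  rw [sComp, h, Real.sqrt_sq hs.le, hF]
  simp only [torField, polField, axisSq_cylPt, PiLp.add_apply]
  simp [cylPt]
  field_simp
  linear_combination P (s ^ 2) z * Real.sin_sq_add_cos_sq φ

lemma cylInt_eq_of_axisymmetric {f : E3 → ℝ} {h : ℝ → ℝ} {s : ℝ}
    (H : ∀ φ, ∀ z ∈ Set.Ioo (-Real.sqrt (1 - s ^ 2)) (Real.sqrt (1 - s ^ 2)),
      f (cylPt s φ z) = h z) :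
    cylInt f s =
      2 * Real.pi * ∫ z in (-Real.sqrt (1 - s ^ 2))..(Real.sqrt (1 - s ^ 2)), h z := by
  have h1 (φ : ℝ) : ∫ z in (-Real.sqrt (1 - s ^ 2))..(Real.sqrt (1 - s ^ 2)), f (cylPt s φ z) =
      ∫ z in (-Real.sqrt (1 - s ^ 2))..(Real.sqrt (1 - s ^ 2)), h z :=
    intervalIntegral.integral_congr_Ioo_of_le
      (neg_le_self (Real.sqrt_nonneg _)) fun z hz => H φ z hz
  simp only [cylInt, h1, intervalIntegral.integral_const, smul_eq_mul, sub_zero]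

/-- The integral of an even polynomial over a symmetric interval. -/
lemma integral_even_polynomial {n : ℕ} (c : Fin n → ℝ) (Z : ℝ) :
    ∫ z in (-Z)..Z, ∑ k, c k * z ^ (2 * (k : ℕ)) =
      2 * Z * ∑ k, c k / (2 * (k : ℕ) + 1) * (Z ^ 2) ^ (k : ℕ) := by
  rw [intervalIntegral.integral_finsetSum fun k _ =>
    (by fun_prop : Continuous fun z : ℝ => c k * z ^ (2 * (k : ℕ))).intervalIntegrable _ _,
    Finset.mul_sum]
  refine Finset.sum_congr rfl fun k _ => ?_
  rw [intervalIntegral.integral_const_mul, integral_pow, Odd.neg_pow ⟨(k : ℕ), rfl⟩, ← pow_mul]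
  push_cast
  have : (2 * (k : ℝ) + 1) ≠ 0 := by positivity
  field_simp
  ring

/-! ### The Taylor–Proudman theorem in the ball -/

lemma gradient_apply (f : E3 → ℝ) (x : E3) (i : Fin 3) : gradient f x i = partialD i f x := by
  have := InnerProductSpace.toDual_symm_apply (𝕜 := ℝ) (x := EuclideanSpace.single i (1 : ℝ))
    (y := fderiv ℝ f x)
  rw [partialD, ← this, gradient, EuclideanSpace.inner_single_right]
  simp

lemma fderiv_eq_sum_partialD (f : E3 → ℝ) (x w : E3) :
    fderiv ℝ f x w = ∑ i, w i * partialD i f x := by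
  have h : w = ∑ i, w i • EuclideanSpace.single i (1 : ℝ) := by
    ext j
    fin_cases j <;> simp [Fin.sum_univ_three]
  conv_lhs => rw [h]
  simp [partialD]

lemma cross_eZ (v : E3) : cross eZ v = !₂[-v 1, v 0, 0] := by
  ext i
  fin_cases i <;> simp [cross, eZ, crossProduct]

lemma divergence_congr {F G : E3 → E3} {x : E3} (h : F =ᶠ[nhds x] G) :
    divergence F x = divergence G x := by
  have e (i : Fin 3) : (fun y => F y i) =ᶠ[nhds x] fun y => G y i := h.mono fun y hy => by
    simp only [hy]
  simp only [divergence, partialD, (e _).fderiv_eq]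

lemma hasDerivAt_cylPt_z (s φ z : ℝ) :
    HasDerivAt (fun t => cylPt s φ t) (EuclideanSpace.single 2 1) z := by
  rw [hasDerivAt_iff_hasFDerivAt, ← hasFDerivWithinAt_univ, hasFDerivWithinAt_piLp]
  intro i
  rw [hasFDerivWithinAt_univ]
  fin_cases i
  · exact (hasFDerivAt_const (s * Real.cos φ) z).congr_fderiv (by ext; simp)
  · exact (hasFDerivAt_const (s * Real.sin φ) z).congr_fderiv (by ext; simp)
  · exact (hasDerivAt_id z).hasFDerivAt.congr_fderiv (by ext; simp)

lemma hasDerivAt_cylPt_phi (s φ z : ℝ) :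
    HasDerivAt (fun t => cylPt s t z) (s • ePhi φ) φ := by
  rw [hasDerivAt_iff_hasFDerivAt, ← hasFDerivWithinAt_univ, hasFDerivWithinAt_piLp]
  intro i
  rw [hasFDerivWithinAt_univ]
  fin_cases i
  · exact ((Real.hasDerivAt_cos φ).const_mul s).hasFDerivAt.congr_fderiv (by ext; simp [ePhi])
  · exact ((Real.hasDerivAt_sin φ).const_mul s).hasFDerivAt.congr_fderiv (by ext; simp [ePhi])
  · exact (hasFDerivAt_const z φ).congr_fderiv (by ext; simp [ePhi])

section
variable {v : E3 → E3} {q : E3 → ℝ}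

/-- If the Coriolis force is a pressure gradient, the symmetry of the second derivatives of the
pressure forces `∂v/∂z = 0`, once `v` is divergence-free. -/
lemma partialD_two_eq_zero (hd : ContDiffOn ℝ 1 v (Metric.ball 0 1))
    (hq : DifferentiableOn ℝ q (Metric.ball 0 1))
    (hbal : ∀ x ∈ Metric.ball (0 : E3) 1, cross eZ (v x) = -gradient q x)
    (hdiv : ∀ x ∈ Metric.ball (0 : E3) 1, divergence v x = 0)
    {x : E3} (hx : x ∈ Metric.ball (0 : E3) 1) (i : Fin 3) :
    partialD 2 (fun y => v y i) x = 0 := by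
  have hmem {y : E3} (hy : y ∈ Metric.ball (0 : E3) 1) := Metric.isOpen_ball.mem_nhds hy
  have hvi (i : Fin 3) : DifferentiableAt ℝ (fun y => v y i) x :=
    (differentiableAt_piLp 2).1 ((hd.contDiffAt (hmem hx)).differentiableAt (by norm_num)) i
  have h1 : ∀ᶠ y in nhds x, HasFDerivAt q (v y 1 • EuclideanSpace.proj (𝕜 := ℝ) (0 : Fin 3)
      - v y 0 • EuclideanSpace.proj (𝕜 := ℝ) (1 : Fin 3)) y := by
    filter_upwards [hmem hx] with y hy
    refine ((hq y hy).differentiableAt (hmem hy)).hasFDerivAt.congr_fderiv ?_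
    have e (j : Fin 3) : partialD j q y = -cross eZ (v y) j := by
      rw [hbal y hy, ← gradient_apply]; simp
    ext w
    rw [fderiv_eq_sum_partialD, Fin.sum_univ_three, e, e, e, cross_eZ]
    simp
    ring
  have h2 := ((hvi 1).hasFDerivAt.smul_const (EuclideanSpace.proj (𝕜 := ℝ) (0 : Fin 3))).sub
    ((hvi 0).hasFDerivAt.smul_const (EuclideanSpace.proj (𝕜 := ℝ) (1 : Fin 3)))
  have h3 (j k : Fin 3) := second_derivative_symmetric_of_eventually h1 h2
    (EuclideanSpace.single j 1) (EuclideanSpace.single k 1)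
  have a := h3 2 0
  have b := h3 2 1
  have c := h3 1 0
  have d := hdiv x hx
  simp [divergence, Fin.sum_univ_three] at a b c d
  change partialD 2 _ x = 0 at a
  change partialD 2 _ x = 0 at b
  change partialD 1 _ x = -partialD 0 _ x at c
  fin_cases i
  · exact b
  · exact a
  · simp only [Fin.reduceFinMk]; linarith

/-- Hence `v` is constant along every vertical chord of the closed ball. -/
lemma eq_of_vertical (hc : ContinuousOn v (Metric.closedBall 0 1))
    (hd : DifferentiableOn ℝ v (Metric.ball 0 1))
    (h2 : ∀ x ∈ Metric.ball (0 : E3) 1, ∀ i, partialD 2 (fun y => v y i) x = 0)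
    {s φ a b : ℝ} (hab : a < b) (ha : s ^ 2 + a ^ 2 ≤ 1) (hb : s ^ 2 + b ^ 2 ≤ 1) :
    v (cylPt s φ a) = v (cylPt s φ b) := by
  have hZ {t : ℝ} (h : s ^ 2 + t ^ 2 ≤ 1) : |t| ≤ Real.sqrt (1 - s ^ 2) :=
    Real.abs_le_sqrt (by linarith)
  have hcont (i : Fin 3) : ContinuousOn (fun t => v (cylPt s φ t) i) (Set.Icc a b) := by
    have h1 : ContinuousOn (fun t => v (cylPt s φ t)) (Set.Icc a b) := by
      refine hc.comp (fun t _ => (hasDerivAt_cylPt_z s φ t).continuousAt.continuousWithinAt)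
        fun t ht => cylPt_mem_closedBall.2 ?_
      have : t ^ 2 ≤ max (a ^ 2) (b ^ 2) := by
        rcases le_total 0 t with h | h
        · exact le_max_of_le_right (by nlinarith [ht.2])
        · exact le_max_of_le_left (by nlinarith [ht.1])
      rcases le_max_iff.1 this with h | h <;> linarith
    exact (EuclideanSpace.proj (𝕜 := ℝ) i).continuous.comp_continuousOn h1
  have hder (i : Fin 3) : ∀ t ∈ Set.Ioo a b, HasDerivAt (fun t => v (cylPt s φ t) i) 0 t := by
    intro t ht
    have hm : cylPt s φ t ∈ Metric.ball (0 : E3) 1 := by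
      rw [cylPt_mem_ball]
      rcases le_total 0 t with h | h
      · nlinarith [ht.2]
      · nlinarith [ht.1]
    have hv : DifferentiableAt ℝ (fun y => v y i) (cylPt s φ t) :=
      (differentiableAt_piLp 2).1 ((hd _ hm).differentiableAt (Metric.isOpen_ball.mem_nhds hm)) i
    have := hv.hasFDerivAt.comp_hasDerivAt t (hasDerivAt_cylPt_z s φ t)
    rw [← h2 _ hm i]
    exact this
  ext i
  obtain ⟨c, -, h⟩ := exists_hasDerivAt_eq_slope _ _ hab (hcont i) (hder i)
  have : b - a ≠ 0 := by linarith
  field_simp at h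
  linarith

/-- The Taylor–Proudman theorem for the unit ball: a flow that is tangent to the sphere and whose
Coriolis force is a pressure gradient is azimuthal and depends on the distance from the axis only. -/
lemma exists_geostrophic (hc : ContinuousOn v (Metric.closedBall 0 1))
    (hd : ContDiffOn ℝ 1 v (Metric.ball 0 1)) (hq : DifferentiableOn ℝ q (Metric.ball 0 1))
    (hbal : ∀ x ∈ Metric.ball (0 : E3) 1, cross eZ (v x) = -gradient q x)
    (hdiv : ∀ x ∈ Metric.ball (0 : E3) 1, divergence v x = 0)
    (himp : ∀ x ∈ Metric.sphere (0 : E3) 1, inner ℝ (v x) x = 0) {s : ℝ}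
    (hs : s ∈ Set.Ioo (0 : ℝ) 1) :
    ∃ k : ℝ, ∀ φ z, s ^ 2 + z ^ 2 ≤ 1 → v (cylPt s φ z) = k • ePhi φ := by
  have hd1 : DifferentiableOn ℝ v (Metric.ball 0 1) := hd.differentiableOn (by norm_num)
  have h2 : ∀ x ∈ Metric.ball (0 : E3) 1, ∀ i, partialD 2 (fun y => v y i) x = 0 :=
    fun x hx => partialD_two_eq_zero hd hq hbal hdiv hx
  have hcol {r φ z : ℝ} (hz : r ^ 2 + z ^ 2 ≤ 1) : v (cylPt r φ z) = v (cylPt r φ 0) := by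
    have h0 : r ^ 2 + (0 : ℝ) ^ 2 ≤ 1 := by nlinarith
    rcases lt_trichotomy z 0 with h | h | h
    · exact eq_of_vertical hc hd1 h2 h hz h0
    · rw [h]
    · exact (eq_of_vertical hc hd1 h2 h h0 hz).symm
  -- tangency at the top and at the bottom of a column removes `v_z` and `v_s`
  have htan {r : ℝ} (hr : 0 < r) (hr1 : r < 1) (φ : ℝ) :
      v (cylPt r φ 0) 2 = 0 ∧ Real.cos φ * v (cylPt r φ 0) 0 + Real.sin φ * v (cylPt r φ 0) 1 = 0 := by
    have hpos : 0 < 1 - r ^ 2 := by nlinarith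
    have hZ := Real.sq_sqrt hpos.le
    have hZ0 := Real.sqrt_pos.2 hpos
    set Z := Real.sqrt (1 - r ^ 2)
    have hin (z : ℝ) (hz : z ^ 2 = 1 - r ^ 2) :
        r * (Real.cos φ * v (cylPt r φ 0) 0 + Real.sin φ * v (cylPt r φ 0) 1)
          + z * v (cylPt r φ 0) 2 = 0 := by
      have hsph : cylPt r φ z ∈ Metric.sphere (0 : E3) 1 := by
        rw [mem_sphere_zero_iff_norm, ← sq_eq_sq₀ (norm_nonneg _) zero_le_one, norm_sq_cylPt]
        linarith
      have := himp _ hsph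
      rw [hcol (by linarith), PiLp.inner_apply, Fin.sum_univ_three] at this
      simp [cylPt] at this ⊢
      linarith
    have e1 := hin Z hZ
    have e2 := hin (-Z) (by rw [neg_sq, hZ])
    have e3 : Z * v (cylPt r φ 0) 2 = 0 := by linarith
    have e4 : r * (Real.cos φ * v (cylPt r φ 0) 0 + Real.sin φ * v (cylPt r φ 0) 1) = 0 := by
      linarith
    exact ⟨(mul_eq_zero.1 e3).resolve_left hZ0.ne', (mul_eq_zero.1 e4).resolve_left hr.ne'⟩
  have hrad : ∀ x ∈ Metric.ball (0 : E3) 1, x 0 * v x 0 + x 1 * v x 1 = 0 := by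
    intro x hx
    obtain ⟨r, φ, z, hr, rfl⟩ := exists_eq_cylPt x
    rw [cylPt_mem_ball] at hx
    rw [hcol hx.le]
    rcases hr.eq_or_lt with rfl | hr
    · simp [cylPt]
    · have := (htan hr (by nlinarith [sq_nonneg z]) φ).2
      simp only [cylPt, PiLp.toLp_apply, Matrix.cons_val_zero, Matrix.cons_val_one] at this ⊢
      linear_combination r * this
  -- with `v_s = 0`, incompressibility makes `v_φ` constant on circles about the axis
  have hcirc (φ : ℝ) : HasDerivAt (fun t => cylPt s t 0 0 * v (cylPt s t 0) 1
      - cylPt s t 0 1 * v (cylPt s t 0) 0) 0 φ := by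
    have hm : cylPt s φ 0 ∈ Metric.ball (0 : E3) 1 := by
      rw [cylPt_mem_ball]; nlinarith [hs.1, hs.2]
    set x := cylPt s φ 0 with hxdef
    have hv (i : Fin 3) : DifferentiableAt ℝ (fun y => v y i) x :=
      (differentiableAt_piLp 2).1
        ((hd1 _ hm).differentiableAt (Metric.isOpen_ball.mem_nhds hm)) i
    have c0 := differentiableAt_coord 0 x
    have c1 := differentiableAt_coord 1 x
    have hrad0 (j : Fin 3) :
        partialD j (fun y => y 0 * v y 0 + y 1 * v y 1) x = 0 := by
      have : (fun y => y 0 * v y 0 + y 1 * v y 1) =ᶠ[nhds x] fun _ => (0 : ℝ) := by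
        filter_upwards [Metric.isOpen_ball.mem_nhds hm] with y hy using hrad y hy
      rw [partialD, this.fderiv_eq]
      simp
    have g0 := hrad0 0
    have g1 := hrad0 1
    rw [partialD_add _ (c0.fun_mul (hv 0)) (c1.fun_mul (hv 1)), partialD_coord_mul _ _ (hv 0),
      partialD_coord_mul _ _ (hv 1)] at g0 g1
    have hdv := hdiv x hm
    rw [divergence, Fin.sum_univ_three, h2 x hm 2] at hdv
    have hf : DifferentiableAt ℝ (fun y => y 0 * v y 1 - y 1 * v y 0) x :=
      (c0.fun_mul (hv 1)).fun_sub (c1.fun_mul (hv 0))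
    have hcomp := hf.hasFDerivAt.comp_hasDerivAt φ (hasDerivAt_cylPt_phi s φ 0)
    refine hcomp.congr_deriv ?_
    have k (j : Fin 3) : partialD j (fun y => y 0 * v y 1 - y 1 * v y 0) x =
        partialD j (fun y => y 0 * v y 1) x - partialD j (fun y => y 1 * v y 0) x := by
      rw [partialD, fderiv_fun_sub (c0.fun_mul (hv 1)) (c1.fun_mul (hv 0))]
      rfl
    have w0 : (s • ePhi φ) 0 = -x 1 := by simp [hxdef, cylPt, ePhi]
    have w1 : (s • ePhi φ) 1 = x 0 := by simp [hxdef, cylPt, ePhi]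
    have w2 : (s • ePhi φ) 2 = 0 := by simp [ePhi]
    rw [fderiv_eq_sum_partialD, Fin.sum_univ_three, w0, w1, w2, k, k,
      partialD_coord_mul _ _ (hv 0), partialD_coord_mul _ _ (hv 1),
      partialD_coord_mul _ _ (hv 0), partialD_coord_mul _ _ (hv 1)]
    norm_num at g0 g1 ⊢
    linear_combination (x 0 ^ 2 + x 1 ^ 2) * hdv - x 0 * g0 - x 1 * g1
  have hconst (φ : ℝ) := is_const_of_deriv_eq_zero (fun t => (hcirc t).differentiableAt)
    (fun t => (hcirc t).deriv) φ 0
  refine ⟨v (cylPt s 0 0) 1, fun φ z hz => ?_⟩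
  have h1 := hconst φ
  obtain ⟨t2, t1⟩ := htan hs.1 hs.2 φ
  rw [hcol hz]
  have c0 (t : ℝ) : cylPt s t 0 0 = s * Real.cos t := rfl
  have c1 (t : ℝ) : cylPt s t 0 1 = s * Real.sin t := rfl
  rw [c0, c1, c0, c1, Real.cos_zero, Real.sin_zero] at h1
  have h1' : Real.cos φ * v (cylPt s φ 0) 1 - Real.sin φ * v (cylPt s φ 0) 0 =
      v (cylPt s 0 0) 1 := by
    apply mul_left_cancel₀ hs.1.ne'
    linarith
  have cs := Real.sin_sq_add_cos_sq φ
  ext i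
  fin_cases i
  · simp [ePhi]
    linear_combination Real.cos φ * t1 - Real.sin φ * h1' - v (cylPt s φ 0) 0 * cs
  · simp [ePhi]
    linear_combination Real.sin φ * t1 + Real.cos φ * h1' - v (cylPt s φ 0) 1 * cs
  · simpa [ePhi] using t2

end

/-! ### Integrals over the columns -/

lemma ampA_sq : ampA ^ 2 = 231 / 20584 := Real.sq_sqrt (by norm_num)

/-- The flow has zero average over each column. In this and the following integrals the displayed
vector lists the coefficients of `1, z², z⁴, …` in the integrand, up to the power of `ampA` in front. -/
lemma integral_flowT {ρ Z : ℝ} (hZ : Z ^ 2 = 1 - ρ) :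
    ∫ z in (-Z)..Z, flowT ρ z = 0 := by
  have e : (fun z => flowT ρ z) = fun z => ampA ^ 2 * ∑ k,
      (![9120 * ρ ^ 3 - 26184 * ρ ^ 2 + 23888 * ρ - 6824, 50400 * ρ ^ 2 - 95760 * ρ +
          42000, 50400 * ρ - 47880, 16800] : Fin 4 → ℝ) k
        * z ^ (2 * (k : ℕ)) := by
    ext z
    simp [Fin.sum_univ_succ, flowT, -mul_eq_mul_left_iff]
    ring
  simp only [e]
  rw [intervalIntegral.integral_const_mul, integral_even_polynomial, hZ, ampA_sq]
  simp [Fin.sum_univ_succ, -mul_eq_zero]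
  ring

lemma integral_magP_sq {ρ Z : ℝ} (hZ : Z ^ 2 = 1 - ρ) :
    ∫ z in (-Z)..Z, magP ρ z ^ 2 =
      99 / 2573 * Z * (1 - ρ) * (640 * ρ ^ 2 - 1168 * ρ + 535) := by
  have e : (fun z => magP ρ z ^ 2) = fun z => ampA ^ 2 * ∑ k,
      (![0, 14400 * ρ ^ 2 - 27360 * ρ + 12996, 28800 * ρ - 27360, 14400] : Fin 4 → ℝ) k
        * z ^ (2 * (k : ℕ)) := by
    ext z
    simp [Fin.sum_univ_succ, magP]
    ring
  simp only [e]
  rw [intervalIntegral.integral_const_mul, integral_even_polynomial, hZ, ampA_sq]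
  simp [Fin.sum_univ_succ]
  ring

/-- The integrand is `2 B_s² + s B · ∇B_s` divided by `s²`. -/
lemma integral_beta {ρ Z : ℝ} (hZ : Z ^ 2 = 1 - ρ) :
    ∫ z in (-Z)..Z, (3 * magP ρ z ^ 2 + 2 * ρ * magP ρ z * (ampA * (-120 * z))
        + magR ρ z * (ampA * (-120 * ρ - 360 * z ^ 2 + 114))) =
      -(99 / 2573) * Z * (7680 * ρ ^ 3 - 17440 * ρ ^ 2 + 12456 * ρ - 2689) := by
  have e : (fun z => (3 * magP ρ z ^ 2 + 2 * ρ * magP ρ z * (ampA * (-120 * z))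
        + magR ρ z * (ampA * (-120 * ρ - 360 * z ^ 2 + 114)))) = fun z => ampA ^ 2 * ∑ k,
      (![-21600 * ρ ^ 3 + 47880 * ρ ^ 2 - 31992 * ρ + 5700, -21600 * ρ ^ 2 + 13680 * ρ
          + 7992, 21600 * ρ - 34200, 21600] : Fin 4 → ℝ) k
        * z ^ (2 * (k : ℕ)) := by
    ext z
    simp [Fin.sum_univ_succ, magP, magR]
    ring
  simp only [e]
  rw [intervalIntegral.integral_const_mul, integral_even_polynomial, hZ, ampA_sq]
  simp [Fin.sum_univ_succ]
  ring

lemma integral_magP_mul_indT {ρ Z : ℝ} (hZ : Z ^ 2 = 1 - ρ) :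
    ∫ z in (-Z)..Z, magP ρ z * indT ρ z =
      33264 / 86064277 * Z * (1 - ρ) ^ 2 *
        (46387200 * ρ ^ 4 - 138624000 * ρ ^ 3 + 142265512 * ρ ^ 2 - 57599212 * ρ + 7255185) := by
  have e : (fun z => magP ρ z * indT ρ z) = fun z => ampA ^ 4 * ∑ k,
      (![0, -1389312000 * ρ ^ 5 + 5957798400 * ρ ^ 4 - 9944478720 * ρ ^ 3 + 8055287424
          * ρ ^ 2 - 3158095104 * ρ + 478800000, -4955904000 * ρ ^ 4 + 17549568000 * ρ ^
          3 - 22766423040 * ρ ^ 2 + 12863796480 * ρ - 2687328000, -7921152000 * ρ ^ 3 +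
          21933849600 * ρ ^ 2 - 19870387200 * ρ + 5936353920, -7257600000 * ρ ^ 2 +
          13789440000 * ρ - 6449587200, -3628800000 * ρ + 3447360000, -725760000] : Fin 7 → ℝ) k
        * z ^ (2 * (k : ℕ)) := by
    ext z
    simp [Fin.sum_univ_succ, magP, indT]
    ring
  simp only [e]
  rw [intervalIntegral.integral_const_mul, integral_even_polynomial, hZ, show ampA ^ 4 = (231 / 20584) ^ 2 by rw [← ampA_sq]; ring]
  simp [Fin.sum_univ_succ]
  ring

/-- The integrand is the azimuthal component of `(∇ × Cᵃ) × B + (∇ × B) × Cᵃ` divided by `s`. -/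
lemma integral_direct {ρ Z : ℝ} (hZ : Z ^ 2 = 1 - ρ) :
    ∫ z in (-Z)..Z, ((2 * indT ρ z + 2 * ρ * indTρ ρ z) * magP ρ z + indTz ρ z * magR ρ z) =
      -(33264 / 86064277) * Z * (-788582400 * ρ ^ 6 + 3424588800 * ρ ^ 5 - 5871698056 * ρ ^ 4
        + 5008127804 * ρ ^ 3 - 2183964721 * ρ ^ 2 + 440479243 * ρ - 28950670) := by
  have e : (fun z => ((2 * indT ρ z + 2 * ρ * indTρ ρ z) * magP ρ z + indTz ρ z * magR ρ z)) = fun z => ampA ^ 4 * ∑ k,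
      (![2083968000 * ρ ^ 6 - 9596620800 * ρ ^ 5 + 17698625280 * ρ ^ 4 - 16646162688 *
          ρ ^ 3 + 8371867008 * ρ ^ 2 - 2121676800 * ρ + 210000000, 4935168000 * ρ ^ 5 -
          23478336000 * ρ ^ 4 + 42558935040 * ρ ^ 3 - 36981820800 * ρ ^ 2 + 15363698688
          * ρ - 2394000000, 12327552000 * ρ ^ 4 - 51694848000 * ρ ^ 3 + 75152494080 * ρ
          ^ 2 - 45260881920 * ρ + 9405648000, 24717312000 * ρ ^ 3 - 70218316800 * ρ ^ 2
          + 63191808000 * ρ - 17809061760, 23587200000 * ρ ^ 2 - 41368320000 * ρ +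
          17736364800, 10160640000 * ρ - 8963136000, 1814400000] : Fin 7 → ℝ) k
        * z ^ (2 * (k : ℕ)) := by
    ext z
    simp [Fin.sum_univ_succ, magP, magR, indT, indTρ, indTz]
    ring
  simp only [e]
  rw [intervalIntegral.integral_const_mul, integral_even_polynomial, hZ, show ampA ^ 4 = (231 / 20584) ^ 2 by rw [← ampA_sq]; ring]
  simp [Fin.sum_univ_succ]
  ring

/-! ### Existence and uniqueness of the ageostrophic flow -/

lemma phiComp_torField_cylPt (T : ℝ → ℝ → ℝ) {s : ℝ} (hs : 0 < s) (φ z : ℝ) :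
    phiComp (torField T) (cylPt s φ z) = s * T (s ^ 2) z := by
  refine phiComp_cylPt (P := fun _ _ => 0) (R := fun _ _ => 0) hs ?_
  ext i
  fin_cases i <;> simp [polField]

lemma sq_sqrt_one_sub_sq {s : ℝ} (hs : s ∈ Set.Ioo (0 : ℝ) 1) :
    Real.sqrt (1 - s ^ 2) ^ 2 = 1 - s ^ 2 :=
  Real.sq_sqrt (by nlinarith [hs.1, hs.2])

lemma gradient_sub_of_differentiableAt {p q : E3 → ℝ} {x : E3} (hp : DifferentiableAt ℝ p x)
    (hq : DifferentiableAt ℝ q x) :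
    gradient (fun y => p y - q y) x = gradient p x - gradient q x := by
  ext i
  simp [gradient_apply, partialD, fderiv_fun_sub hp hq]

/-- A flow that equals the explicit azimuthal flow on the closed ball is ageostrophic. -/
lemma isAgeostrophicFlow_of_eqOn {u : E3 → E3}
    (hu : ∀ x ∈ Metric.closedBall (0 : E3) 1, u x = torField flowT x) :
    IsAgeostrophicFlow dipoleB u where
  continuousOn := (differentiable_torField hasPartials_flowT).continuous.continuousOn.congr hu
  contDiffOn := (contDiff_torField (by unfold flowT; fun_prop)).contDiffOn.congr fun x hx =>
    hu x (Metric.ball_subset_closedBall hx)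
  balance := by
    refine ⟨fun x => pressureF (axisSq x) (x 2),
      fun x _ => (hasPartials_pressureF.differentiableAt_axisym x).differentiableWithinAt,
      fun x hx => ?_⟩
    rw [hu x (Metric.ball_subset_closedBall hx), cross_eZ, lorentz_dipoleB]
    ext i
    rw [PiLp.add_apply, PiLp.neg_apply, gradient_apply, partialD_axisym hasPartials_pressureF]
    fin_cases i <;> simp [torField, polField] <;> ring
  incompressible := fun x hx => by
    have e : u =ᶠ[nhds x] torField flowT := by
      filter_upwards [Metric.isOpen_ball.mem_nhds hx] with y hy
      exact hu y (Metric.ball_subset_closedBall hy)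
    rw [divergence_congr e, divergence_torField hasPartials_flowT]
  impenetrable := fun x hx => by
    rw [hu x (Metric.sphere_subset_closedBall hx), PiLp.inner_apply, Fin.sum_univ_three]
    simp [torField]
    ring
  zero_average := fun s hs => by
    rw [cylInt_eq_of_axisymmetric (h := fun z => s * flowT (s ^ 2) z) fun φ z hz => ?_,
      intervalIntegral.integral_const_mul, integral_flowT (sq_sqrt_one_sub_sq hs)]
    · ring
    · rw [← phiComp_torField_cylPt flowT hs.1 φ z, phiComp, phiComp,
        hu _ (cylPt_mem_closedBall.2 (sq_lt_of_mem_Ioo_sqrt hz).le)]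

/-- The columns of radius strictly between `0` and `1` are dense in the closed ball. -/
lemma closedBall_subset_closure_columns :
    Metric.closedBall (0 : E3) 1 ⊆
      closure {x | ∃ s ∈ Set.Ioo (0 : ℝ) 1, ∃ φ z, s ^ 2 + z ^ 2 ≤ 1 ∧ x = cylPt s φ z} := by
  intro x hx
  obtain ⟨s, φ, z, hs, rfl⟩ := exists_eq_cylPt x
  rw [cylPt_mem_closedBall] at hx
  have hs1 : s ≤ 1 := by nlinarith [sq_nonneg z]
  have hcont : Continuous fun p : ℝ × ℝ => cylPt p.1 φ p.2 := by
    unfold cylPt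
    fun_prop
  have hev : ∀ᶠ t : ℝ in nhdsWithin 0 (Set.Ioi 0), t ∈ Set.Ioo (0 : ℝ) 1 :=
    Ioo_mem_nhdsGT zero_lt_one
  -- approach along `s ↦ (1 - t) s + t (1 - s) / 2`, `z ↦ (1 - t) z`, which leaves `s = 0` and `s = 1`
  have hpath : Continuous fun t : ℝ =>
      cylPt ((1 - t) * s + t / 2 * (1 - s)) φ ((1 - t) * z) :=
    hcont.comp (by fun_prop : Continuous fun t : ℝ =>
      ((1 - t) * s + t / 2 * (1 - s), (1 - t) * z))
  have hlim := (hpath.tendsto 0).mono_left (nhdsWithin_le_nhds (s := Set.Ioi 0))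
  simp only [sub_zero, one_mul, zero_mul, add_zero, zero_div] at hlim
  refine mem_closure_of_tendsto hlim (hev.mono fun t ht => ?_)
  refine ⟨(1 - t) * s + t / 2 * (1 - s), ⟨?_, ?_⟩, φ, (1 - t) * z, ?_, rfl⟩
  · rcases hs.eq_or_lt with rfl | h
    · linarith [ht.1]
    · nlinarith [mul_pos (sub_pos.2 ht.2) h, mul_nonneg ht.1.le (sub_nonneg.2 hs1)]
  · nlinarith [ht.1, ht.2, mul_nonneg ht.1.le (sub_nonneg.2 hs1), mul_nonneg ht.1.le hs]
  · have h1 : (1 - t) ^ 2 * (s ^ 2 + z ^ 2) ≤ (1 - t) ^ 2 :=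
      mul_le_of_le_one_right (sq_nonneg _) hx
    have ha : (t / 2 * (1 - s)) ≤ t / 2 := by nlinarith [ht.1]
    have hb : (1 - t) * s * (1 - s) ≤ (1 - t) * (1 / 4) := by
      have : s * (1 - s) ≤ 1 / 4 := by nlinarith [sq_nonneg (s - 1 / 2)]
      nlinarith [ht.2]
    have hc : 0 ≤ t / 2 * (1 - s) := mul_nonneg (by linarith [ht.1]) (by linarith)
    nlinarith [ht.1, ht.2, mul_nonneg ht.1.le (sub_nonneg.2 hs1), mul_pos ht.1 (sub_pos.2 ht.2),
      mul_le_mul_of_nonneg_left hb ht.1.le, mul_le_mul ha ha hc (by linarith [ht.1])]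

lemma isAgeostrophicFlow_iff_eqOn {u : E3 → E3} :
    IsAgeostrophicFlow dipoleB u ↔
      ∀ x ∈ Metric.closedBall (0 : E3) 1, u x = torField flowT x := by
  refine ⟨fun hu => ?_, isAgeostrophicFlow_of_eqOn⟩
  have hw : IsAgeostrophicFlow dipoleB (torField flowT) := isAgeostrophicFlow_of_eqOn fun _ _ => rfl
  have hmem {y : E3} (hy : y ∈ Metric.ball (0 : E3) 1) := Metric.isOpen_ball.mem_nhds hy
  obtain ⟨p, hp, hpb⟩ := hu.balance
  obtain ⟨q, hq, hqb⟩ := hw.balance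
  have hcol : ∀ s ∈ Set.Ioo (0 : ℝ) 1, ∀ φ z, s ^ 2 + z ^ 2 ≤ 1 →
      u (cylPt s φ z) = torField flowT (cylPt s φ z) := by
    intro s hs
    obtain ⟨k, hk⟩ := exists_geostrophic (v := fun x => u x - torField flowT x)
      (q := fun x => p x - q x) (hu.continuousOn.sub hw.continuousOn)
      (hu.contDiffOn.sub hw.contDiffOn) (hp.sub hq)
      (fun x hx => by
        have h1 := hpb x hx
        have h2 := hqb x hx
        rw [cross_eZ] at h1 h2 ⊢
        rw [gradient_sub_of_differentiableAt ((hp x hx).differentiableAt (hmem hx))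
          ((hq x hx).differentiableAt (hmem hx))]
        trans !₂[-u x 1, u x 0, 0] - !₂[-torField flowT x 1, torField flowT x 0, 0]
        · ext i
          fin_cases i <;> simp
          ring
        · rw [h1, h2]
          abel)
      (fun x hx => by
        have du (i) := (differentiableAt_piLp 2).1
          ((hu.contDiffOn.contDiffAt (hmem hx)).differentiableAt (by norm_num)) i
        have dw (i) := (differentiableAt_piLp 2).1
          ((hw.contDiffOn.contDiffAt (hmem hx)).differentiableAt (by norm_num)) i
        have h1 := hu.incompressible x hx
        have h2 := hw.incompressible x hx
        simp only [divergence, Fin.sum_univ_three, partialD, PiLp.sub_apply] at h1 h2 ⊢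
        simp only [fderiv_fun_sub (du _) (dw _), sub_apply]
        linarith)
      (fun x hx => by
        rw [inner_sub_left, hu.impenetrable x hx, hw.impenetrable x hx, sub_zero]) hs
    have hphi : ∀ φ z, s ^ 2 + z ^ 2 ≤ 1 →
        phiComp u (cylPt s φ z) = s * flowT (s ^ 2) z + k := by
      intro φ z hz
      have h1 : u (cylPt s φ z) = torField (fun ρ z => flowT ρ z + k / s) (cylPt s φ z) := by
        have := hk φ z hz
        rw [sub_eq_iff_eq_add, torField_cylPt, ← add_smul] at this
        rw [this, torField_cylPt]
        congr 1
        have := hs.1.ne'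
        field_simp
        ring
      have h2 := phiComp_torField_cylPt (fun ρ z => flowT ρ z + k / s) hs.1 φ z
      rw [phiComp] at h2 ⊢
      rw [h1, h2]
      have := hs.1.ne'
      field_simp
    have h0 := hu.zero_average s hs
    have hZ := sq_sqrt_one_sub_sq hs
    have hcts : Continuous fun z => s * flowT (s ^ 2) z := by unfold flowT; fun_prop
    rw [cylInt_eq_of_axisymmetric fun φ z hz => hphi φ z (sq_lt_of_mem_Ioo_sqrt hz).le,
      intervalIntegral.integral_add (hcts.intervalIntegrable _ _) (by simp),
      intervalIntegral.integral_const_mul, integral_flowT hZ] at h0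
    have hZ0 : 0 < Real.sqrt (1 - s ^ 2) := Real.sqrt_pos.2 (by nlinarith [hs.1, hs.2])
    simp [Real.pi_ne_zero, hZ0.ne'] at h0
    intro φ z hz
    have := hk φ z hz
    rw [h0, zero_smul] at this
    exact sub_eq_zero.1 this
  refine Set.EqOn.of_subset_closure (f := u) (g := torField flowT) (s := {x | ∃ s ∈ Set.Ioo (0 : ℝ) 1,
    ∃ φ z, s ^ 2 + z ^ 2 ≤ 1 ∧ x = cylPt s φ z}) ?_ hu.continuousOn hw.continuousOn ?_
    closedBall_subset_closure_columns
  · rintro x ⟨s, hs, φ, z, hz, rfl⟩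
    exact hcol s hs φ z hz
  · rintro x ⟨s, hs, φ, z, hz, rfl⟩
    exact cylPt_mem_closedBall.2 hz

lemma torField_flowT_cylPt (s φ z : ℝ) :
    torField flowT (cylPt s φ z) = dipoleUPhi s z • ePhi φ := by
  rw [torField_cylPt, flowT, dipoleUPhi]
  congr 1
  ring

lemma isAgeostrophicFlow_iff {u : E3 → E3} :
    IsAgeostrophicFlow dipoleB u ↔
      ∀ s φ z : ℝ, 0 ≤ s → s ^ 2 + z ^ 2 ≤ 1 → u (cylPt s φ z) = dipoleUPhi s z • ePhi φ := by
  rw [isAgeostrophicFlow_iff_eqOn]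
  constructor
  · intro h s φ z _ hz
    rw [h _ (cylPt_mem_closedBall.2 hz), torField_flowT_cylPt]
  · intro h x hx
    obtain ⟨s, φ, z, hs, rfl⟩ := exists_eq_cylPt x
    rw [h s φ z hs (cylPt_mem_closedBall.1 hx), torField_flowT_cylPt]

/-! ### The coefficients of the two equations -/

lemma torField_zero (x : E3) : torField (fun _ _ => 0) x = 0 := by
  ext i
  fin_cases i <;> simp [torField]

lemma sComp_dipoleB_cylPt {s : ℝ} (hs : 0 < s) (φ z : ℝ) :
    sComp dipoleB (cylPt s φ z) = s * magP (s ^ 2) z :=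
  sComp_cylPt hs (R := magR) (T := fun _ _ => 0) (by rw [torField_zero, add_zero, dipoleB_eq])

lemma phiComp_dipoleB_cylPt {s : ℝ} (hs : 0 < s) (φ z : ℝ) :
    phiComp dipoleB (cylPt s φ z) = 0 := by
  rw [phiComp_cylPt hs (P := magP) (R := magR) (T := fun _ _ => 0)
    (by rw [torField_zero, add_zero, dipoleB_eq]), mul_zero]

lemma isTaylorState_dipoleB : IsTaylorState dipoleB := fun s hs => by
  rw [taylorIntegral, cylInt_eq_of_axisymmetric (h := fun _ => 0) fun φ z _ => ?_]
  · simp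
  · rw [phiComp_cylPt hs.1 (P := fun ρ z => curJ ρ z * magR ρ z)
      (R := fun ρ z => -(ρ * curJ ρ z * magP ρ z)) (T := fun _ _ => 0)
      (by rw [torField_zero, add_zero, lorentz_dipoleB]), mul_zero, zero_mul]

lemma sqrt_one_sub_sq_pow_three {s : ℝ} (hs : s ∈ Set.Ioo (0 : ℝ) 1) :
    Real.sqrt (1 - s ^ 2) ^ 3 = Real.sqrt (1 - s ^ 2) * (1 - s ^ 2) := by
  rw [pow_succ', sq_sqrt_one_sub_sq hs]

lemma sqrt_one_sub_sq_pow_five {s : ℝ} (hs : s ∈ Set.Ioo (0 : ℝ) 1) :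
    Real.sqrt (1 - s ^ 2) ^ 5 = Real.sqrt (1 - s ^ 2) * (1 - s ^ 2) ^ 2 := by
  rw [pow_succ', show 4 = 2 * 2 from rfl, pow_mul, sq_sqrt_one_sub_sq hs]

lemma alpha0_dipoleB {s : ℝ} (hs : s ∈ Set.Ioo (0 : ℝ) 1) :
    alpha0 dipoleB s = 198 / 2573 * s ^ 4 * Real.pi * Real.sqrt (1 - s ^ 2) ^ 3 *
        (640 * s ^ 4 - 1168 * s ^ 2 + 535) := by
  have hZ := sq_sqrt_one_sub_sq hs
  simp only [alpha0, sComp_dipoleB_cylPt hs.1, mul_pow]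
  rw [intervalIntegral.integral_const_mul, integral_magP_sq hZ, sqrt_one_sub_sq_pow_three hs]
  ring

lemma alpha_dipoleB {s : ℝ} (hs : s ∈ Set.Ioo (0 : ℝ) 1) :
    alpha dipoleB s = 198 / 2573 * s ^ 4 * Real.pi * Real.sqrt (1 - s ^ 2) ^ 3 *
        (640 * s ^ 4 - 1168 * s ^ 2 + 535) := by
  have hZ := sq_sqrt_one_sub_sq hs
  rw [alpha, cylInt_eq_of_axisymmetric (h := fun z => s ^ 4 * magP (s ^ 2) z ^ 2) fun φ z _ => ?_,
    intervalIntegral.integral_const_mul, integral_magP_sq hZ, sqrt_one_sub_sq_pow_three hs]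
  · ring
  · rw [sComp_dipoleB_cylPt hs.1]
    ring

/-- The formula also holds on the axis, where both sides are `0`. -/
lemma sComp_dipoleB (x : E3) :
    sComp dipoleB x = Real.sqrt (axisSq x) * magP (axisSq x) (x 2) := by
  have : x 0 * dipoleB x 0 + x 1 * dipoleB x 1 = axisSq x * magP (axisSq x) (x 2) := by
    rw [dipoleB_eq]
    simp [polField, axisSq]
    ring
  rw [sComp, this, ← axisSq, mul_div_right_comm, Real.div_sqrt]

/-- The derivative of `B_s` along the field lines. -/
lemma fderiv_sComp_dipoleB {s : ℝ} (hs : 0 < s) (φ z : ℝ) :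
    fderiv ℝ (sComp dipoleB) (cylPt s φ z) (dipoleB (cylPt s φ z)) =
      s * (magP (s ^ 2) z ^ 2 + 2 * s ^ 2 * magP (s ^ 2) z * (ampA * (-120 * z))
        + magR (s ^ 2) z * (ampA * (-120 * s ^ 2 - 360 * z ^ 2 + 114))) := by
  have e : sComp dipoleB = fun x => Real.sqrt (axisSq x) * magP (axisSq x) (x 2) :=
    funext sComp_dipoleB
  set x := cylPt s φ z with hx
  have hρ : axisSq x = s ^ 2 := axisSq_cylPt s φ z
  have h1 : DifferentiableAt ℝ axisSq x := HasPartials.fst.differentiableAt_axisym x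
  have h1' (v : E3) : fderiv ℝ axisSq x v = 2 * (x 0 * v 0 + x 1 * v 1) := by
    have := HasPartials.fst.fderiv_axisym x v
    simp only [one_mul, zero_mul, add_zero] at this
    exact this
  have h2 : HasFDerivAt (fun x => Real.sqrt (axisSq x)) _ x :=
    h1.hasFDerivAt.sqrt (by rw [hρ]; positivity)
  have hv : x 0 * dipoleB x 0 + x 1 * dipoleB x 1 = s ^ 2 * magP (s ^ 2) z := by
    rw [dipoleB_eq, ← hρ]
    simp [polField, axisSq, hx, cylPt_two]
    ring
  have hv2 : dipoleB x 2 = magR (s ^ 2) z := by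
    rw [dipoleB_eq, ← hρ]
    simp [polField, hx, cylPt_two]
  rw [e, fderiv_fun_mul h2.differentiableAt (hasPartials_magP.differentiableAt_axisym x),
    add_apply, smul_apply, smul_apply,
    hasPartials_magP.fderiv_axisym, h2.fderiv, smul_apply, h1', hv, hv2, hρ,
    Real.sqrt_sq hs.le, show x 2 = z from rfl]
  simp only [smul_eq_mul]
  field_simp
  ring

lemma beta_dipoleB {s : ℝ} (hs : s ∈ Set.Ioo (0 : ℝ) 1) :
    beta dipoleB s = -(198 / 2573) * s ^ 3 * Real.pi * Real.sqrt (1 - s ^ 2) *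
        (7680 * s ^ 6 - 17440 * s ^ 4 + 12456 * s ^ 2 - 2689) := by
  have hZ := sq_sqrt_one_sub_sq hs
  rw [beta, cylInt_eq_of_axisymmetric (h := fun z => s ^ 3 * (3 * magP (s ^ 2) z ^ 2
        + 2 * s ^ 2 * magP (s ^ 2) z * (ampA * (-120 * z))
        + magR (s ^ 2) z * (ampA * (-120 * s ^ 2 - 360 * z ^ 2 + 114)))) fun φ z _ => ?_,
    intervalIntegral.integral_const_mul, integral_beta hZ]
  · ring
  · rw [sComp_dipoleB_cylPt hs.1, fderiv_sComp_dipoleB hs.1]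
    ring

section
variable {η : ℝ} {u : E3 → E3}

lemma inductionC_cylPt_eq (hu : ∀ x ∈ Metric.ball (0 : E3) 1, u x = torField flowT x) {s φ z : ℝ}
    (hz : z ∈ Set.Ioo (-Real.sqrt (1 - s ^ 2)) (Real.sqrt (1 - s ^ 2))) :
    inductionC η dipoleB u (cylPt s φ z) =
      polField (fun _ z => η * (ampA * (-1680 * z)))
        (fun ρ z => η * (ampA * (3360 * ρ + 1680 * z ^ 2 - 1140))) (cylPt s φ z)
        + torField indT (cylPt s φ z) := by
  rw [inductionC_eq η hu (cylPt_mem_ball.2 (sq_lt_of_mem_Ioo_sqrt hz)), add_comm]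
  congr 1
  ext i
  fin_cases i <;> simp [polField] <;> ring

/-- The integrand `B_s Cᵃ_φ + B_φ Cᵃ_s`: the diffusive part of `Cᵃ` does not contribute. -/
lemma sComp_mul_phiComp_inductionC (hu : ∀ x ∈ Metric.ball (0 : E3) 1, u x = torField flowT x)
    {s φ z : ℝ} (hs : 0 < s)
    (hz : z ∈ Set.Ioo (-Real.sqrt (1 - s ^ 2)) (Real.sqrt (1 - s ^ 2))) :
    sComp dipoleB (cylPt s φ z) * phiComp (inductionC η dipoleB u) (cylPt s φ z)
        + phiComp dipoleB (cylPt s φ z) * sComp (inductionC η dipoleB u) (cylPt s φ z) =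
      s ^ 2 * (magP (s ^ 2) z * indT (s ^ 2) z) := by
  rw [phiComp_dipoleB_cylPt hs, sComp_dipoleB_cylPt hs,
    phiComp_cylPt hs (inductionC_cylPt_eq hu hz)]
  ring

lemma S0_dipoleB (hu : ∀ x ∈ Metric.ball (0 : E3) 1, u x = torField flowT x) {s : ℝ}
    (hs : s ∈ Set.Ioo (0 : ℝ) 1) :
    S0 η dipoleB u s = 66528 / 86064277 * s ^ 4 * Real.pi * Real.sqrt (1 - s ^ 2) ^ 5 *
          (46387200 * s ^ 8 - 138624000 * s ^ 6 + 142265512 * s ^ 4 - 57599212 * s ^ 2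
            + 7255185) := by
  have hZ := sq_sqrt_one_sub_sq hs
  rw [S0, intervalIntegral.integral_congr_Ioo_of_le (neg_le_self (Real.sqrt_nonneg _))
    fun z hz => sComp_mul_phiComp_inductionC hu hs.1 hz,
    intervalIntegral.integral_const_mul, integral_magP_mul_indT hZ, sqrt_one_sub_sq_pow_five hs]
  ring

/-- The function differentiated in Taylor's `G` is `S₀`. -/
lemma sq_mul_cylInt_eq_S0 {s : ℝ} (hu : ∀ x ∈ Metric.ball (0 : E3) 1, u x = torField flowT x)
    (hs : s ∈ Set.Ioo (0 : ℝ) 1) :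
    s ^ 2 * cylInt (fun x => phiComp (inductionC η dipoleB u) x * sComp dipoleB x
      + sComp (inductionC η dipoleB u) x * phiComp dipoleB x) s = S0 η dipoleB u s := by
  rw [S0, intervalIntegral.integral_congr_Ioo_of_le (neg_le_self (Real.sqrt_nonneg _))
    fun z hz => sComp_mul_phiComp_inductionC hu hs.1 hz,
    cylInt_eq_of_axisymmetric (h := fun z => s ^ 2 * (magP (s ^ 2) z * indT (s ^ 2) z))
      fun φ z hz => by
        rw [← sComp_mul_phiComp_inductionC (η := η) (φ := φ) hu hs.1 hz]
        ring]
  ring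

lemma hasDerivAt_sqrt_one_sub_sq {s : ℝ} (hs : s ∈ Set.Ioo (0 : ℝ) 1) :
    HasDerivAt (fun t => Real.sqrt (1 - t ^ 2)) (-s / Real.sqrt (1 - s ^ 2)) s := by
  have h : HasDerivAt (fun t : ℝ => 1 - t ^ 2) (-(2 * s)) s := by
    simpa using (hasDerivAt_pow 2 s).const_sub 1
  refine (h.sqrt (by nlinarith [hs.1, hs.2])).congr_deriv ?_
  rw [neg_div, neg_div, mul_div_mul_left _ _ two_ne_zero]

lemma taylorG_dipoleB (hu : ∀ x ∈ Metric.ball (0 : E3) 1, u x = torField flowT x) {s : ℝ}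
    (hs : s ∈ Set.Ioo (0 : ℝ) 1) :
    taylorG η dipoleB u s = Real.sqrt (1 - s ^ 2) * (66528 / 86064277 * Real.pi *
      (-788582400 * s ^ 14 + 3424588800 * s ^ 12 - 5871698056 * s ^ 10 + 5007407084 * s ^ 8
        - 2182607365 * s ^ 6 + 439912677 * s ^ 4 - 29020740 * s ^ 2)) := by
  have hZ := sq_sqrt_one_sub_sq hs
  have hZ0 : Real.sqrt (1 - s ^ 2) ≠ 0 :=
    (Real.sqrt_pos.2 (by nlinarith [hs.1, hs.2])).ne'
  have e : (fun t => t ^ 2 * cylInt (fun x => phiComp (inductionC η dipoleB u) x * sComp dipoleB x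
      + sComp (inductionC η dipoleB u) x * phiComp dipoleB x) t) =ᶠ[nhds s] fun t =>
      66528 / 86064277 * Real.pi * (t ^ 4 * Real.sqrt (1 - t ^ 2) ^ 5 *
        (46387200 * t ^ 8 - 138624000 * t ^ 6 + 142265512 * t ^ 4 - 57599212 * t ^ 2
          + 7255185)) := by
    filter_upwards [Ioo_mem_nhds hs.1 hs.2] with t ht
    rw [sq_mul_cylInt_eq_S0 hu ht, S0_dipoleB hu ht]
    ring
  have hp : HasDerivAt (fun t : ℝ => 46387200 * t ^ 8 - 138624000 * t ^ 6 + 142265512 * t ^ 4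
      - 57599212 * t ^ 2 + 7255185) (371097600 * s ^ 7 - 831744000 * s ^ 5 + 569062048 * s ^ 3
      - 115198424 * s) s := by
    have := (((((hasDerivAt_pow 8 s).const_mul 46387200).sub
      ((hasDerivAt_pow 6 s).const_mul 138624000)).add
      ((hasDerivAt_pow 4 s).const_mul 142265512)).sub
      ((hasDerivAt_pow 2 s).const_mul 57599212)).add_const 7255185
    refine this.congr_deriv ?_
    simp only [Nat.cast_ofNat, Nat.reduceSub]
    ring
  have hd := ((((hasDerivAt_pow 4 s).fun_mul ((hasDerivAt_sqrt_one_sub_sq hs).fun_pow 5)).fun_mul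
    hp).const_mul (66528 / 86064277 * Real.pi))
  rw [taylorG, e.deriv_eq, hd.deriv]
  have hs0 := hs.1.ne'
  simp only [Nat.cast_ofNat, Nat.reduceSub]
  set Z := Real.sqrt (1 - s ^ 2)
  have h5 : Z ^ 5 = Z * (1 - s ^ 2) ^ 2 := sqrt_one_sub_sq_pow_five hs
  have h6 : 5 * Z ^ 4 * (-s / Z) = -5 * s * (Z * (1 - s ^ 2)) := by
    rw [← hZ]; field_simp
  rw [h5, h6]
  field_simp
  ring

lemma taylorGDirect_dipoleB (hu : ∀ x ∈ Metric.ball (0 : E3) 1, u x = torField flowT x) {s : ℝ}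
    (hs : s ∈ Set.Ioo (0 : ℝ) 1) :
    taylorGDirect η dipoleB u s = Real.sqrt (1 - s ^ 2) * (66528 / 86064277 * Real.pi *
      (-788582400 * s ^ 14 + 3424588800 * s ^ 12 - 5871698056 * s ^ 10 + 5008127804 * s ^ 8
        - 2183964721 * s ^ 6 + 440479243 * s ^ 4 - 28950670 * s ^ 2)) := by
  have hZ := sq_sqrt_one_sub_sq hs
  rw [taylorGDirect, cylInt_eq_of_axisymmetric (h := fun z => s ^ 2 *
      ((2 * indT (s ^ 2) z + 2 * s ^ 2 * indTρ (s ^ 2) z) * magP (s ^ 2) z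
        + indTz (s ^ 2) z * magR (s ^ 2) z)) fun φ z hz => ?_,
    intervalIntegral.integral_const_mul, integral_direct hZ]
  · ring
  have hm := cylPt_mem_ball (φ := φ).2 (sq_lt_of_mem_Ioo_sqrt hz)
  -- the diffusive part of `Cᵃ` only contributes a meridional force
  have hF : cross (curl (inductionC η dipoleB u) (cylPt s φ z)) (dipoleB (cylPt s φ z))
        + cross (curl dipoleB (cylPt s φ z)) (inductionC η dipoleB u (cylPt s φ z)) =
      polField
        (fun ρ z => η * (-8400 * ampA * magR ρ z
          + curJ ρ z * (ampA * (3360 * ρ + 1680 * z ^ 2 - 1140))))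
        (fun ρ z => η * (-(ρ * (-8400 * ampA) * magP ρ z)
          - ρ * curJ ρ z * (ampA * (-1680 * z)))) (cylPt s φ z)
      + torField (fun ρ z => (2 * indT ρ z + 2 * ρ * indTρ ρ z) * magP ρ z
          - (-indTz ρ z) * magR ρ z) (cylPt s φ z) := by
    rw [curl_inductionC_eq η hu hm, inductionC_eq η hu hm, curl_dipoleB, dipoleB_eq,
      cross_add_left, cross_add_right, cross_smul_left, cross_smul_right, cross_pol_pol,
      cross_tor_pol, cross_tor_pol, cross_tor_tor]
    ext i
    fin_cases i <;> simp [polField, torField] <;> ring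
  have := phiComp_cylPt (F := fun y => cross (curl (inductionC η dipoleB u) y) (dipoleB y)
    + cross (curl dipoleB y) (inductionC η dipoleB u y)) hs.1 hF
  rw [this]
  ring

end

/-! ### Solutions of the first-order equation -/

lemma quartic_pos (s : ℝ) : 0 < 640 * s ^ 4 - 1168 * s ^ 2 + 535 := by
  nlinarith [sq_nonneg (80 * s ^ 2 - 73)]

/-- The derivative of `u_g / s` forced by the first-order equation: `-S₀ / (s α₀)`. -/
noncomputable def shearRate (s : ℝ) : ℝ :=
  -(336 / 33449) * ((1 - s ^ 2) * (46387200 * s ^ 8 - 138624000 * s ^ 6 + 142265512 * s ^ 4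
    - 57599212 * s ^ 2 + 7255185)) / (s * (640 * s ^ 4 - 1168 * s ^ 2 + 535))

lemma alpha0_mul_shearRate {η : ℝ} {u : E3 → E3}
    (hu : ∀ x ∈ Metric.ball (0 : E3) 1, u x = torField flowT x) {s : ℝ}
    (hs : s ∈ Set.Ioo (0 : ℝ) 1) :
    s * alpha0 dipoleB s * shearRate s = -S0 η dipoleB u s := by
  have h0 := hs.1.ne'
  have hq := (quartic_pos s).ne'
  rw [alpha0_dipoleB hs, S0_dipoleB hu hs, shearRate, sqrt_one_sub_sq_pow_three hs,
    sqrt_one_sub_sq_pow_five hs]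
  generalize 640 * s ^ 4 - 1168 * s ^ 2 + 535 = q at hq ⊢
  field_simp
  ring

lemma deriv_eq_shearRate_iff {η : ℝ} {u : E3 → E3}
    (hu : ∀ x ∈ Metric.ball (0 : E3) 1, u x = torField flowT x) {s : ℝ}
    (hs : s ∈ Set.Ioo (0 : ℝ) 1) (d : ℝ) :
    s * alpha0 dipoleB s * d = -S0 η dipoleB u s ↔ d = shearRate s := by
  have hZ : 0 < Real.sqrt (1 - s ^ 2) := Real.sqrt_pos.2 (by nlinarith [hs.1, hs.2])
  have h : s * alpha0 dipoleB s ≠ 0 := by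
    rw [alpha0_dipoleB hs]
    have := hs.1
    have := quartic_pos s
    have := Real.pi_pos
    positivity
  rw [← alpha0_mul_shearRate hu hs]
  exact ⟨fun e => mul_left_cancel₀ h e, fun e => by rw [e]⟩

lemma hasDerivAt_shearRate {s : ℝ} (hs : 0 < s) :
    HasDerivAt shearRate
      (-(336 / 33449) * ((-463872000 * s ^ 9 + 1480089600 * s ^ 7 - 1685337072 * s ^ 5
          + 799458896 * s ^ 3 - 129708794 * s) * (s * (640 * s ^ 4 - 1168 * s ^ 2 + 535))
        - (1 - s ^ 2) * (46387200 * s ^ 8 - 138624000 * s ^ 6 + 142265512 * s ^ 4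
          - 57599212 * s ^ 2 + 7255185) * (3200 * s ^ 4 - 3504 * s ^ 2 + 535))
        / (s * (640 * s ^ 4 - 1168 * s ^ 2 + 535)) ^ 2) s := by
  have hn : HasDerivAt (fun t : ℝ => -(336 / 33449) * ((1 - t ^ 2) * (46387200 * t ^ 8
      - 138624000 * t ^ 6 + 142265512 * t ^ 4 - 57599212 * t ^ 2 + 7255185)))
      (-(336 / 33449) * (-463872000 * s ^ 9 + 1480089600 * s ^ 7 - 1685337072 * s ^ 5
          + 799458896 * s ^ 3 - 129708794 * s)) s := by
    have := (((hasDerivAt_pow 2 s).const_sub 1).fun_mul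
      ((((((hasDerivAt_pow 8 s).const_mul 46387200).sub
      ((hasDerivAt_pow 6 s).const_mul 138624000)).add
      ((hasDerivAt_pow 4 s).const_mul 142265512)).sub
      ((hasDerivAt_pow 2 s).const_mul 57599212)).add_const 7255185)).const_mul (-(336 / 33449))
    refine this.congr_deriv ?_
    simp only [Nat.cast_ofNat, Nat.reduceSub, Pi.add_apply, Pi.sub_apply]
    ring
  have hd : HasDerivAt (fun t : ℝ => t * (640 * t ^ 4 - 1168 * t ^ 2 + 535))
      (3200 * s ^ 4 - 3504 * s ^ 2 + 535) s := by
    have := (hasDerivAt_id s).fun_mul ((((hasDerivAt_pow 4 s).const_mul 640).sub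
      ((hasDerivAt_pow 2 s).const_mul 1168)).add_const 535)
    refine this.congr_deriv ?_
    simp only [Nat.cast_ofNat, Nat.reduceSub, Pi.sub_apply, id]
    ring
  refine (hn.fun_div hd (mul_pos hs (quartic_pos s)).ne').congr_deriv ?_
  congr 1
  ring

/-- The operator of Taylor's equation along solutions of the first-order equation. -/
lemma taylorL_of_solvesBWR {η : ℝ} {u : E3 → E3}
    (hu : ∀ x ∈ Metric.ball (0 : E3) 1, u x = torField flowT x) {a b : ℝ} (ha : 0 ≤ a) (hb : b ≤ 1)
    {ug : ℝ → ℝ} (h : SolvesBWR η dipoleB u (Set.Ioo a b) ug) {s : ℝ} (hs : s ∈ Set.Ioo a b) :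
    taylorL dipoleB ug s = Real.sqrt (1 - s ^ 2) * (66528 / 86064277 * Real.pi *
      (-504692736000 * s ^ 18 + 3112801075200 * s ^ 16 - 8179698058240 * s ^ 14
        + 11895688291968 * s ^ 12 - 10389468804472 * s ^ 10 + 5513724758708 * s ^ 8
        - 1702884326747 * s ^ 6 + 270157468073 * s ^ 4 - 15627668490 * s ^ 2)) /
      (640 * s ^ 4 - 1168 * s ^ 2 + 535) := by
  have hmem {t : ℝ} (ht : t ∈ Set.Ioo a b) : t ∈ Set.Ioo (0 : ℝ) 1 :=
    ⟨ha.trans_lt ht.1, ht.2.trans_le hb⟩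
  have hd {t : ℝ} (ht : t ∈ Set.Ioo a b) : deriv (fun t => ug t / t) t = shearRate t :=
    (deriv_eq_shearRate_iff hu (hmem ht) _).1 (h t ht).2
  have hdd : deriv (fun t => ug t / t) =ᶠ[nhds s] shearRate := by
    filter_upwards [Ioo_mem_nhds hs.1 hs.2] with t ht using hd ht
  have h01 := hmem hs
  have h0 := h01.1.ne'
  have hq := (quartic_pos s).ne'
  rw [taylorL, hdd.deriv_eq, hd hs, (hasDerivAt_shearRate h01.1).deriv, alpha_dipoleB h01,
    beta_dipoleB h01, shearRate, sqrt_one_sub_sq_pow_three h01]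
  field_simp
  ring

/-- The explicit solutions, divided by `s`, up to the constant of solid-body rotation. -/
lemma hasDerivAt_dipoleUg_div (C : ℝ) {s : ℝ} (hs : 0 < s) :
    HasDerivAt (fun t => dipoleUg C t / t) (shearRate s) s := by
  have hq := quartic_pos s
  have h21 : (0 : ℝ) < Real.sqrt 21 := Real.sqrt_pos.2 (by norm_num)
  have hsq : Real.sqrt 21 ^ 2 = 21 := Real.sq_sqrt (by norm_num)
  have e : (fun t => dipoleUg C t / t) =ᶠ[nhds s] fun t => ampA ^ 2 / 918060 *
      (9926860800 * t ^ 6 - 32213813760 * t ^ 4 + 37855940880 * t ^ 2 + C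
      - 11143964160 * Real.log t
      + 30664844 * Real.sqrt 21 * Real.arctan ((80 * t ^ 2 - 73) / Real.sqrt 21)
      + 101695629 * Real.log (640 * t ^ 4 - 1168 * t ^ 2 + 535)) := by
    filter_upwards [lt_mem_nhds hs] with t ht
    rw [dipoleUg]
    field_simp
  have hpoly : HasDerivAt (fun t : ℝ => 9926860800 * t ^ 6 - 32213813760 * t ^ 4
      + 37855940880 * t ^ 2 + C)
      (59561164800 * s ^ 5 - 128855255040 * s ^ 3 + 75711881760 * s) s := by
    have := ((((hasDerivAt_pow 6 s).const_mul 9926860800).sub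
      ((hasDerivAt_pow 4 s).const_mul 32213813760)).add
      ((hasDerivAt_pow 2 s).const_mul 37855940880)).add_const C
    refine this.congr_deriv ?_
    simp only [Nat.cast_ofNat, Nat.reduceSub]
    ring
  have hlog := (Real.hasDerivAt_log hs.ne').const_mul 11143964160
  have hatan : HasDerivAt (fun t : ℝ => 30664844 * Real.sqrt 21 *
      Real.arctan ((80 * t ^ 2 - 73) / Real.sqrt 21))
      (30664844 * 336 * s / (640 * s ^ 4 - 1168 * s ^ 2 + 535)) s := by
    have h1 : HasDerivAt (fun t : ℝ => (80 * t ^ 2 - 73) / Real.sqrt 21)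
        (160 * s / Real.sqrt 21) s := by
      refine ((((hasDerivAt_pow 2 s).const_mul 80).sub_const 73).div_const _).congr_deriv ?_
      simp only [Nat.cast_ofNat, Nat.reduceSub]
      ring
    refine (h1.arctan.const_mul _).congr_deriv ?_
    have hden : 1 + ((80 * s ^ 2 - 73) / Real.sqrt 21) ^ 2 =
        10 * (640 * s ^ 4 - 1168 * s ^ 2 + 535) / 21 := by
      rw [div_pow, hsq]
      ring
    rw [hden]
    field_simp
    ring
  have hlogq : HasDerivAt (fun t : ℝ => 101695629 * Real.log (640 * t ^ 4 - 1168 * t ^ 2 + 535))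
      (101695629 * ((2560 * s ^ 3 - 2336 * s) / (640 * s ^ 4 - 1168 * s ^ 2 + 535))) s := by
    have h1 : HasDerivAt (fun t : ℝ => 640 * t ^ 4 - 1168 * t ^ 2 + 535)
        (2560 * s ^ 3 - 2336 * s) s := by
      refine ((((hasDerivAt_pow 4 s).const_mul 640).sub
        ((hasDerivAt_pow 2 s).const_mul 1168)).add_const 535).congr_deriv ?_
      simp only [Nat.cast_ofNat, Nat.reduceSub]
      ring
    exact (h1.log hq.ne').const_mul _
  refine (((((hpoly.sub hlog).add hatan).add hlogq).const_mul
    (ampA ^ 2 / 918060)).congr_deriv ?_).congr_of_eventuallyEq e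
  rw [ampA_sq, shearRate]
  have h0 := hs.ne'
  have hq' := hq.ne'
  generalize hQ : 640 * s ^ 4 - 1168 * s ^ 2 + 535 = Q at hq' ⊢
  field_simp
  rw [← hQ]
  ring

lemma solvesBWR_iff {η : ℝ} {u : E3 → E3}
    (hu : ∀ x ∈ Metric.ball (0 : E3) 1, u x = torField flowT x) (ug : ℝ → ℝ) :
    SolvesBWR η dipoleB u (Set.Ioo 0 1) ug ↔
      ∃ C : ℝ, ∀ s ∈ Set.Ioo (0 : ℝ) 1, ug s = dipoleUg C s := by
  constructor
  · intro h
    have hder : ∀ s ∈ Set.Ioo (0 : ℝ) 1,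
        HasDerivAt (fun t => ug t / t - dipoleUg 0 t / t) 0 s := fun s hs => by
      have h1 := (h s hs).1.hasDerivAt
      rw [(deriv_eq_shearRate_iff hu hs _).1 (h s hs).2] at h1
      simpa using h1.fun_sub (hasDerivAt_dipoleUg_div 0 hs.1)
    have hhalf : (1 / 2 : ℝ) ∈ Set.Ioo (0 : ℝ) 1 := by norm_num
    have hconst : ∀ s ∈ Set.Ioo (0 : ℝ) 1, ug s / s - dipoleUg 0 s / s =
        ug (1 / 2) / (1 / 2) - dipoleUg 0 (1 / 2) / (1 / 2) := fun s hs =>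
      isOpen_Ioo.is_const_of_deriv_eq_zero isPreconnected_Ioo
        (fun t ht => (hder t ht).differentiableAt.differentiableWithinAt)
        (fun t ht => (hder t ht).deriv) hs hhalf
    set k := ug (1 / 2) / (1 / 2) - dipoleUg 0 (1 / 2) / (1 / 2)
    refine ⟨k * 918060 / ampA ^ 2, fun s hs => ?_⟩
    have h1 := hconst s hs
    have h0 := hs.1.ne'
    have h2 : dipoleUg (k * 918060 / ampA ^ 2) s = dipoleUg 0 s + k * s := by
      have : ampA ≠ 0 := by
        intro h
        have := ampA_sq
        rw [h] at this
        norm_num at this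
      rw [dipoleUg, dipoleUg]
      field_simp
      ring
    rw [h2]
    field_simp at h1
    linarith
  · rintro ⟨C, hC⟩ s hs
    have h : HasDerivAt (fun t => ug t / t) (shearRate s) s := by
      refine (hasDerivAt_dipoleUg_div C hs.1).congr_of_eventuallyEq ?_
      filter_upwards [Ioo_mem_nhds hs.1 hs.2] with t ht
      rw [hC t ht]
    exact ⟨h.differentiableAt, by rw [h.deriv, alpha0_mul_shearRate hu hs]⟩

lemma continuous_dipoleUg (C : ℝ) : Continuous (dipoleUg C) := by
  have e : dipoleUg C = fun s => ampA ^ 2 / 918060 *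
      (s * (9926860800 * s ^ 6 - 32213813760 * s ^ 4 + 37855940880 * s ^ 2 + C)
      - 11143964160 * (s * Real.log s)
      + s * (30664844 * Real.sqrt 21 * Real.arctan ((80 * s ^ 2 - 73) / Real.sqrt 21))
      + s * (101695629 * Real.log (640 * s ^ 4 - 1168 * s ^ 2 + 535))) := by
    ext s
    rw [dipoleUg]
    ring
  have h1 := Real.continuous_mul_log
  have h2 : Continuous fun s : ℝ => Real.log (640 * s ^ 4 - 1168 * s ^ 2 + 535) :=
    Continuous.log (by fun_prop) fun s => (quartic_pos s).ne'
  have h3 : Continuous fun s : ℝ => Real.arctan ((80 * s ^ 2 - 73) / Real.sqrt 21) :=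
    Real.continuous_arctan.comp (by fun_prop)
  rw [e]
  fun_prop

lemma analyticAt_dipoleUg (C : ℝ) {s : ℝ} (hs : 0 < s) : AnalyticAt ℝ (dipoleUg C) s := by
  have h1 : ContDiffAt ℝ ⊤ Real.log s := Real.contDiffAt_log.2 hs.ne'
  have h2 : ContDiffAt ℝ ⊤ (fun s : ℝ => Real.log (640 * s ^ 4 - 1168 * s ^ 2 + 535)) s :=
    ContDiffAt.log (by fun_prop) (quartic_pos s).ne'
  have h3 : ContDiffAt ℝ ⊤ (fun s : ℝ => Real.arctan ((80 * s ^ 2 - 73) / Real.sqrt 21)) s :=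
    Real.contDiff_arctan.contDiffAt.comp s (by fun_prop)
  have h : ContDiffAt ℝ ⊤ (dipoleUg C) s := by
    unfold dipoleUg
    fun_prop
  exact h.analyticAt

lemma tendsto_mul_deriv_dipoleUg_div (C : ℝ) :
    Filter.Tendsto (fun s => s * deriv (fun t => dipoleUg C t / t) s)
      (nhdsWithin 0 (Set.Ioi 0)) (nhds (-(336 / 33449) * 7255185 / 535)) := by
  have hc : Continuous fun s : ℝ => -(336 / 33449) * ((1 - s ^ 2) * (46387200 * s ^ 8
      - 138624000 * s ^ 6 + 142265512 * s ^ 4 - 57599212 * s ^ 2 + 7255185)) /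
      (640 * s ^ 4 - 1168 * s ^ 2 + 535) :=
    Continuous.div (by fun_prop) (by fun_prop) fun s => (quartic_pos s).ne'
  have h := (hc.tendsto 0).mono_left (nhdsWithin_le_nhds (s := Set.Ioi 0))
  norm_num at h ⊢
  refine h.congr' ?_
  filter_upwards [self_mem_nhdsWithin] with s hs
  have h0 : s ≠ 0 := (Set.mem_Ioi.1 hs).ne'
  have hq := (quartic_pos s).ne'
  rw [(hasDerivAt_dipoleUg_div C hs).deriv, shearRate]
  field_simp

/-! ### Global angular momentum -/

lemma angularMomentum_integrand {u : E3 → E3}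
    (hu : ∀ x ∈ Metric.ball (0 : E3) 1, u x = torField flowT x) (C : ℝ) {s : ℝ}
    (hs : s ∈ Set.Ioo (0 : ℝ) 1) :
    cylInt (fun x => s * (phiComp u x + dipoleUg C s)) s * s =
      4 * Real.pi * (s ^ 2 * Real.sqrt (1 - s ^ 2) * dipoleUg 0 s)
        + 4 * Real.pi * (ampA ^ 2 / 918060) * C * (s ^ 3 * Real.sqrt (1 - s ^ 2)) := by
  have hcts : Continuous fun z => s ^ 2 * flowT (s ^ 2) z := by unfold flowT; fun_prop
  rw [cylInt_eq_of_axisymmetric (h := fun z => s ^ 2 * flowT (s ^ 2) z + s * dipoleUg C s)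
    fun φ z hz => ?_,
    intervalIntegral.integral_add (hcts.intervalIntegrable _ _) (by simp),
    intervalIntegral.integral_const_mul, integral_flowT (sq_sqrt_one_sub_sq hs),
    intervalIntegral.integral_const, smul_eq_mul,
    show dipoleUg C s = dipoleUg 0 s + ampA ^ 2 / 918060 * C * s by rw [dipoleUg, dipoleUg]; ring]
  · ring
  · have h := phiComp_torField_cylPt flowT hs.1 φ z
    rw [phiComp] at h ⊢
    rw [hu _ (cylPt_mem_ball.2 (sq_lt_of_mem_Ioo_sqrt hz)), h]
    ring

/-- The angular momentum is an affine function of `C` with non-zero slope. -/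
lemma existsUnique_angularMomentum_eq_zero {u : E3 → E3}
    (hu : ∀ x ∈ Metric.ball (0 : E3) 1, u x = torField flowT x) :
    ∃! C : ℝ, (∫ s in (0 : ℝ)..1,
      cylInt (fun x => s * (phiComp u x + dipoleUg C s)) s * s) = 0 := by
  have c1 : Continuous fun s : ℝ => s ^ 2 * Real.sqrt (1 - s ^ 2) * dipoleUg 0 s := by
    have := continuous_dipoleUg 0
    fun_prop
  have c2 : Continuous fun s : ℝ => s ^ 3 * Real.sqrt (1 - s ^ 2) := by fun_prop
  have hpos : 0 < ∫ s in (0 : ℝ)..1, s ^ 3 * Real.sqrt (1 - s ^ 2) :=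
    intervalIntegral.intervalIntegral_pos_of_pos_on (c2.intervalIntegrable _ _)
      (fun s hs => mul_pos (pow_pos hs.1 3) (Real.sqrt_pos.2 (by nlinarith [hs.1, hs.2])))
      zero_lt_one
  set K := ∫ s in (0 : ℝ)..1, s ^ 3 * Real.sqrt (1 - s ^ 2)
  set J := ∫ s in (0 : ℝ)..1, s ^ 2 * Real.sqrt (1 - s ^ 2) * dipoleUg 0 s
  have hI (C : ℝ) : (∫ s in (0 : ℝ)..1,
      cylInt (fun x => s * (phiComp u x + dipoleUg C s)) s * s) =
      4 * Real.pi * J + 4 * Real.pi * (ampA ^ 2 / 918060) * C * K := by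
    rw [intervalIntegral.integral_congr_Ioo_of_le zero_le_one
      fun s hs => angularMomentum_integrand hu C hs,
      intervalIntegral.integral_add ((c1.const_mul _).intervalIntegrable _ _)
        ((c2.const_mul _).intervalIntegrable _ _),
      intervalIntegral.integral_const_mul, intervalIntegral.integral_const_mul]
  simp only [hI, ampA_sq]
  have hπ := Real.pi_ne_zero
  have hK := hpos.ne'
  refine ⟨-J / (231 / 20584 / 918060 * K), ?_, fun C hC => ?_⟩
  · simp only
    field_simp
    ring
  · have h1 : J + 231 / 20584 / 918060 * C * K = 0 := by
      have : 4 * Real.pi * (J + 231 / 20584 / 918060 * C * K) = 0 := by linarith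
      simpa [hπ] using this
    rw [eq_div_iff (by positivity)]
    linarith

/-! ### Incompatibility of the two equations -/

open Polynomial in
/-- The numerator of `L_T(u_g) / √(1 - s²)` along solutions of the first-order equation, as a
polynomial in `s²` without its scalar factor; the denominator is `polyQ2`. -/
noncomputable def numeratorPoly : ℝ[X] :=
  C (-504692736000) * X ^ 9 + C 3112801075200 * X ^ 8 + C (-8179698058240) * X ^ 7
    + C 11895688291968 * X ^ 6 + C (-10389468804472) * X ^ 5 + C 5513724758708 * X ^ 4
    + C (-1702884326747) * X ^ 3 + C 270157468073 * X ^ 2 + C (-15627668490) * X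

open Polynomial in
/-- The right side `G / √(1 - s²)` as a polynomial in `s²`, without its scalar factor. -/
noncomputable def sourcePoly : ℝ[X] :=
  C (-788582400) * X ^ 7 + C 3424588800 * X ^ 6 + C (-5871698056) * X ^ 5 + C 5007407084 * X ^ 4
    + C (-2182607365) * X ^ 3 + C 439912677 * X ^ 2 + C (-29020740) * X

open Polynomial in
/-- The right side obtained by direct substitution of `Cᵃ`, divided by `√(1 - s²)`, as a polynomial
in `s²`, without its scalar factor. -/
noncomputable def sourcePolyDirect : ℝ[X] :=
  C (-788582400) * X ^ 7 + C 3424588800 * X ^ 6 + C (-5871698056) * X ^ 5 + C 5008127804 * X ^ 4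
    + C (-2183964721) * X ^ 3 + C 440479243 * X ^ 2 + C (-28950670) * X

/-- The scalar factor common to both sides of Taylor's equation. -/
noncomputable def commonFactor : ℝ := 66528 / 86064277 * Real.pi

lemma commonFactor_ne_zero : commonFactor ≠ 0 := by
  unfold commonFactor
  positivity

lemma natDegree_numeratorPoly : numeratorPoly.natDegree = 9 := by
  unfold numeratorPoly
  compute_degree!

lemma natDegree_sourcePoly : sourcePoly.natDegree = 7 := by
  unfold sourcePoly
  compute_degree!

lemma natDegree_sourcePolyDirect : sourcePolyDirect.natDegree = 7 := by
  unfold sourcePolyDirect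
  compute_degree!

lemma natDegree_polyQ2 : polyQ2.natDegree = 2 := by
  unfold polyQ2
  compute_degree!

lemma eval_polyQ2 (s : ℝ) : polyQ2.eval (s ^ 2) = 640 * s ^ 4 - 1168 * s ^ 2 + 535 := by
  simp [polyQ2]
  ring

open Polynomial in
/-- The remainder of the numerator modulo `polyQ2` is linear and non-zero; a Bézout identity between
the two makes numerator and denominator coprime. -/
lemma isCoprime_numeratorPoly_polyQ2 : IsCoprime numeratorPoly polyQ2 := by
  have h : numeratorPoly = (C (1599558891 / 400) * X + C (-18073444151 / 5120))
      + polyQ2 * (C (-788582400) * X ^ 7 + C 3424588800 * X ^ 6 + C (-5871698056) * X ^ 5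
        + C 5008421804 * X ^ 4 + C (-2184802621) * X ^ 3 + C (3529620403 / 8) * X ^ 2
        + C (-9345172837 / 320) * X + C (168910693 / 25600)) := by
    refine Polynomial.funext fun x => ?_
    simp [numeratorPoly, polyQ2]
    ring
  rw [h]
  refine IsCoprime.add_mul_left_left ?_ _
  refine ⟨C (-305623007232 / 5092915803271135) * X + C (1439888161792 / 25464579016355675),
    C (695924628895008 / 1856018878743125), ?_⟩
  refine Polynomial.funext fun x => ?_
  simp [polyQ2]
  ring

open Polynomial in
lemma ne_mul_polyQ2_of_isCoprime {p : ℝ[X]} (h : IsCoprime p polyQ2) (q : ℝ[X]) :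
    p ≠ q * polyQ2 := by
  rintro rfl
  have hu : IsUnit polyQ2 := isCoprime_self.1 h.of_mul_left_right
  have := natDegree_eq_zero_of_isUnit hu
  rw [natDegree_polyQ2] at this
  norm_num at this

open Polynomial in
/-- Two rational functions of `s²` that agree on an interval agree identically. -/
lemma eq_mul_of_eval_sq_eq {p q d : ℝ[X]} {a b : ℝ} (ha : 0 ≤ a) (hab : a < b)
    (h : ∀ s ∈ Set.Ioo a b, p.eval (s ^ 2) = q.eval (s ^ 2) * d.eval (s ^ 2)) : p = q * d := by
  refine eq_of_infinite_eval_eq _ _ (((Set.Ioo_infinite hab).image ?_ :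
    ((fun s : ℝ => s ^ 2) '' Set.Ioo a b).Infinite).mono ?_)
  · intro x hx y hy hxy
    exact (sq_eq_sq₀ (ha.trans hx.1.le) (ha.trans hy.1.le)).1 hxy
  · rintro _ ⟨s, hs, rfl⟩
    rw [Set.mem_ofPred_eq, eval_mul, h s hs]

section
open Polynomial
variable {η : ℝ} {u : E3 → E3}

lemma taylorG_eq_eval (hu : ∀ x ∈ Metric.ball (0 : E3) 1, u x = torField flowT x) {s : ℝ}
    (hs : s ∈ Set.Ioo (0 : ℝ) 1) :
    taylorG η dipoleB u s =
      Real.sqrt (1 - s ^ 2) * (C commonFactor * sourcePoly).eval (s ^ 2) := by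
  rw [taylorG_dipoleB hu hs]
  simp [commonFactor, sourcePoly, -mul_eq_mul_left_iff]
  ring

lemma taylorGDirect_eq_eval (hu : ∀ x ∈ Metric.ball (0 : E3) 1, u x = torField flowT x) {s : ℝ}
    (hs : s ∈ Set.Ioo (0 : ℝ) 1) :
    taylorGDirect η dipoleB u s =
      Real.sqrt (1 - s ^ 2) * (C commonFactor * sourcePolyDirect).eval (s ^ 2) := by
  rw [taylorGDirect_dipoleB hu hs]
  simp [commonFactor, sourcePolyDirect, -mul_eq_mul_left_iff]
  ring

lemma taylorL_eq_eval (hu : ∀ x ∈ Metric.ball (0 : E3) 1, u x = torField flowT x) {a b : ℝ}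
    (ha : 0 ≤ a) (hb : b ≤ 1) {ug : ℝ → ℝ} (h : SolvesBWR η dipoleB u (Set.Ioo a b) ug) {s : ℝ}
    (hs : s ∈ Set.Ioo a b) :
    taylorL dipoleB ug s = Real.sqrt (1 - s ^ 2) *
      (C commonFactor * numeratorPoly).eval (s ^ 2) / polyQ2.eval (s ^ 2) := by
  rw [taylorL_of_solvesBWR hu ha hb h hs, eval_polyQ2]
  congr 1
  simp [commonFactor, numeratorPoly, -mul_eq_mul_left_iff]
  ring

lemma isCoprime_const_mul_numeratorPoly : IsCoprime (C commonFactor * numeratorPoly) polyQ2 :=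
  (isCoprime_mul_unit_left_left (isUnit_C.2 commonFactor_ne_zero.isUnit) _ _).2
    isCoprime_numeratorPoly_polyQ2

/-- A solution of the first-order equation cannot satisfy a second-order equation whose right side
is `√(1 - s²)` times a polynomial in `s²`. -/
lemma not_solvesTaylor_of_solvesBWR
    (hu : ∀ x ∈ Metric.ball (0 : E3) 1, u x = torField flowT x) {a b : ℝ}
    (ha : 0 ≤ a) (hab : a < b) (hb : b ≤ 1) {ug g : ℝ → ℝ} {q : ℝ[X]}
    (hg : ∀ s ∈ Set.Ioo (0 : ℝ) 1, g s = Real.sqrt (1 - s ^ 2) * q.eval (s ^ 2))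
    (h : SolvesBWR η dipoleB u (Set.Ioo a b) ug) :
    ¬ SolvesTaylor dipoleB g (Set.Ioo a b) ug := by
  intro hT
  refine ne_mul_polyQ2_of_isCoprime isCoprime_const_mul_numeratorPoly q
    (eq_mul_of_eval_sq_eq ha hab fun s hs => ?_)
  have h01 : s ∈ Set.Ioo (0 : ℝ) 1 := ⟨ha.trans_lt hs.1, hs.2.trans_le hb⟩
  have hZ : Real.sqrt (1 - s ^ 2) ≠ 0 :=
    (Real.sqrt_pos.2 (by nlinarith [h01.1, h01.2])).ne'
  have hQ : polyQ2.eval (s ^ 2) ≠ 0 := by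
    rw [eval_polyQ2]
    exact (quartic_pos s).ne'
  have e := (hT s hs).2.2
  rw [taylorL_eq_eval hu ha hb h hs, hg s h01, mul_div_assoc] at e
  have e' := mul_left_cancel₀ hZ e
  rwa [div_eq_iff hQ] at e'

end

lemma insulatingBC_dipoleS : InsulatingBC 1 dipoleS (fun _ => 0) := by
  have h : HasDerivAt dipoleS (2 * ampA) 1 := by
    have := (((hasDerivAt_pow 2 (1 : ℝ)).const_mul ampA).fun_mul
      ((((hasDerivAt_pow 4 (1 : ℝ)).const_mul 30).sub
        ((hasDerivAt_pow 2 (1 : ℝ)).const_mul 57)).add_const 25))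
    refine this.congr_deriv ?_
    simp
    ring
  refine ⟨?_, rfl⟩
  rw [h.deriv, dipoleS]
  push_cast
  ring

theorem mainTheorem2 (η : ℝ) :
    -- the field satisfies the insulating boundary conditions and is a Taylor state
    InsulatingBC 1 dipoleS (fun _ => 0) ∧
    IsTaylorState dipoleB ∧
    -- its ageostrophic flow in the closed unit ball is unique, purely azimuthal and explicit
    (∀ u : E3 → E3, IsAgeostrophicFlow dipoleB u ↔
      ∀ s φ z : ℝ, 0 ≤ s → s ^ 2 + z ^ 2 ≤ 1 → u (cylPt s φ z) = dipoleUPhi s z • ePhi φ) ∧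
    -- the coefficients of the two equations
    (∀ s ∈ Set.Ioo (0 : ℝ) 1,
      alpha0 dipoleB s = alpha dipoleB s ∧
      alpha dipoleB s = 198 / 2573 * s ^ 4 * Real.pi * Real.sqrt (1 - s ^ 2) ^ 3 *
        (640 * s ^ 4 - 1168 * s ^ 2 + 535) ∧
      beta dipoleB s = -(198 / 2573) * s ^ 3 * Real.pi * Real.sqrt (1 - s ^ 2) *
        (7680 * s ^ 6 - 17440 * s ^ 4 + 12456 * s ^ 2 - 2689)) ∧
    ∀ u : E3 → E3, IsAgeostrophicFlow dipoleB u →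
      (∀ s ∈ Set.Ioo (0 : ℝ) 1,
        S0 η dipoleB u s = 66528 / 86064277 * s ^ 4 * Real.pi * Real.sqrt (1 - s ^ 2) ^ 5 *
          (46387200 * s ^ 8 - 138624000 * s ^ 6 + 142265512 * s ^ 4 - 57599212 * s ^ 2
            + 7255185)) ∧
      -- the two sides of Taylor's equation along solutions of the first-order equation
      (∃ Q9 Q7 Q7' : Polynomial ℝ,
        Q9.natDegree = 9 ∧ Q7.natDegree = 7 ∧ Q7'.natDegree = 7 ∧
        IsCoprime Q9 polyQ2 ∧ Q9 ≠ Q7 * polyQ2 ∧ Q9 ≠ Q7' * polyQ2 ∧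
        (∀ s ∈ Set.Ioo (0 : ℝ) 1,
          polyQ2.eval (s ^ 2) ≠ 0 ∧
          taylorG η dipoleB u s = Real.sqrt (1 - s ^ 2) * Q7.eval (s ^ 2) ∧
          taylorGDirect η dipoleB u s = Real.sqrt (1 - s ^ 2) * Q7'.eval (s ^ 2)) ∧
        ∀ a b : ℝ, 0 ≤ a → a < b → b ≤ 1 → ∀ ug : ℝ → ℝ,
          SolvesBWR η dipoleB u (Set.Ioo a b) ug →
          ∀ s ∈ Set.Ioo a b,
            taylorL dipoleB ug s =
              Real.sqrt (1 - s ^ 2) * Q9.eval (s ^ 2) / polyQ2.eval (s ^ 2)) ∧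
      -- no solution of the first-order equation solves Taylor's equation, on any interval
      (∀ a b : ℝ, 0 ≤ a → a < b → b ≤ 1 → ∀ ug : ℝ → ℝ,
        SolvesBWR η dipoleB u (Set.Ioo a b) ug →
        ¬ SolvesTaylor dipoleB (taylorG η dipoleB u) (Set.Ioo a b) ug ∧
        ¬ SolvesTaylor dipoleB (taylorGDirect η dipoleB u) (Set.Ioo a b) ug) ∧
      -- the explicit solutions of the first-order equation
      (∀ ug : ℝ → ℝ, SolvesBWR η dipoleB u (Set.Ioo 0 1) ug ↔
        ∃ C : ℝ, ∀ s ∈ Set.Ioo (0 : ℝ) 1, ug s = dipoleUg C s) ∧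
      -- exactly one of them gives zero global angular momentum
      (∃! C : ℝ, (∫ s in (0 : ℝ)..1,
        cylInt (fun x => s * (phiComp u x + dipoleUg C s)) s * s) = 0) ∧
      -- regularity: continuous on `[0, 1]`, analytic up to `s = 1`, weak singularity at `s = 0`
      (∀ C : ℝ, ContinuousOn (dipoleUg C) (Set.Icc 0 1) ∧
        AnalyticOnNhd ℝ (dipoleUg C) (Set.Ioc 0 1) ∧
        ∃ c : ℝ, c ≠ 0 ∧ Filter.Tendsto (fun s => s * deriv (fun t => dipoleUg C t / t) s)
          (nhdsWithin 0 (Set.Ioi 0)) (nhds c)) := by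
  refine ⟨insulatingBC_dipoleS, isTaylorState_dipoleB, fun u => isAgeostrophicFlow_iff,
    fun s hs => ⟨by rw [alpha0_dipoleB hs, alpha_dipoleB hs], alpha_dipoleB hs, beta_dipoleB hs⟩,
    fun u hflow => ?_⟩
  have hu : ∀ x ∈ Metric.ball (0 : E3) 1, u x = torField flowT x := fun x hx =>
    isAgeostrophicFlow_iff_eqOn.1 hflow x (Metric.ball_subset_closedBall hx)
  refine ⟨fun s hs => S0_dipoleB hu hs, ⟨Polynomial.C commonFactor * numeratorPoly,
    Polynomial.C commonFactor * sourcePoly, Polynomial.C commonFactor * sourcePolyDirect,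
    ?_, ?_, ?_, isCoprime_const_mul_numeratorPoly,
    ne_mul_polyQ2_of_isCoprime isCoprime_const_mul_numeratorPoly _,
    ne_mul_polyQ2_of_isCoprime isCoprime_const_mul_numeratorPoly _,
    fun s hs => ⟨?_, taylorG_eq_eval hu hs, taylorGDirect_eq_eval hu hs⟩,
    fun a b ha _ hb ug h s hs => taylorL_eq_eval hu ha hb h hs⟩,
    fun a b ha hab hb ug h =>
      ⟨not_solvesTaylor_of_solvesBWR hu ha hab hb (fun s hs => taylorG_eq_eval hu hs) h,
        not_solvesTaylor_of_solvesBWR hu ha hab hb (fun s hs => taylorGDirect_eq_eval hu hs) h⟩,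
    solvesBWR_iff hu, existsUnique_angularMomentum_eq_zero hu,
    fun C => ⟨(continuous_dipoleUg C).continuousOn, fun s hs => analyticAt_dipoleUg C hs.1,
      _, by norm_num, tendsto_mul_deriv_dipoleUg_div C⟩⟩
  · rw [Polynomial.natDegree_C_mul commonFactor_ne_zero, natDegree_numeratorPoly]
  · rw [Polynomial.natDegree_C_mul commonFactor_ne_zero, natDegree_sourcePoly]
  · rw [Polynomial.natDegree_C_mul commonFactor_ne_zero, natDegree_sourcePolyDirect]
  · rw [eval_polyQ2]
    exact (quartic_pos s).ne'
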